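/- Let $n\ge 1$ and $r\ge n$ be integers, put $\xi_0=e^{2\pi i/r}$, $\Delta=\prod_{0\le i<j\le r-1}(\xi_0^i-\xi_0^j)$, $S=\mathbb Z[q,q^{-1}]$ and $R=\mathbb Z[q,q^{-1},\xi_0,r^{-1},\Delta^{-1}]$ with $q$ an indeterminate. The Yokonuma–Hecke algebra $\mathcal Y_{r,n}(q)$ is the associative $R$-algebra generated by $g_1,\dots,g_{n-1},t_1,\dots,t_n$ with relations $t_i^r=1$; $t_it_j=t_jt_i$; $t_jg_i=g_it_{s_i(j)}$, where $s_i=(i,i+1)$; $g_ig_j=g_jg_i$ for $|i-j|>1$; $g_ig_{i+1}g_i=g_{i+1}g_ig_{i+1}$; $g_i^2=1+(q-q^{-1})e_ig_i$, where $e_i=\frac1r\sum_{s=0}^{r-1}t_i^st_{i+1}^{-s}$. The algebra of braids and ties $\mathcal E_n(q)$ is the associative $S$-algebra generated by $g_1,\dots,g_{n-1},e_1,\dots,e_{n-1}$ with relations $g_ig_j=g_jg_i$ and $g_ie_j=e_jg_i$ for $|i-j|>1$; $g_ie_i=e_ig_i$; $e_ie_j=e_je_i$; $e_i^2=e_i$;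 $g_i^2=1+(q-q^{-1})e_ig_i$; and, for $|i-j|=1$, $g_ig_jg_i=g_jg_ig_j$, $e_ig_jg_i=g_jg_ie_j$, $e_ie_jg_j=e_ig_je_i=g_je_ie_j$. Let $\mathcal K$ be a commutative ring, let $q\in\mathcal K^\times$, and set $\mathcal E_n^{\mathcal K}(q)=\mathcal E_n(q)\otimes_S\mathcal K$ via $q\mapsto q$. 1. Let $\xi\in\mathcal K^\times$ satisfy $\xi^r=1$, and suppose that $r$ and $\prod_{0\le i<j\le r-1}(\xi^i-\xi^j)$ are invertible in $\mathcal K$. Set $\mathcal Y_{r,n}^{\mathcal K}(q)=\mathcal Y_{r,n}(q)\otimes_R\mathcal K$ via $q\mapsto q$, $\xi_0\mapsto\xi$. Then there is a unique homomorphism of $\mathcal K$-algebras $\varphi:\mathcal E_n^{\mathcal K}(q)\to\mathcal Y_{r,n}^{\mathcal K}(q)$ with $\varphi(g_i)=g_i$ and $\varphi(e_i)=e_i$ for $1\le i\le n-1$, and $\varphi$ is injective. 2. Let $V$ be the free $\mathcal K$-module with basis $\{v_a^t\mid 1\le a\le n,\ 0\le t\le r-1\}$. Let $\mathbf G,\mathbf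 E\in\operatorname{End}_{\mathcal K}(V^{\otimes2})$ act on the right by $$(v_a^t\otimes v_b^s)\mathbf G=\begin{cases}v_b^s\otimes v_a^t& t\ne s,\\ q\,v_a^t\otimes v_b^s& t=s,\ a=b,\\ v_b^s\otimes v_a^t& t=s,\ a>b,\\ (q-q^{-1})v_a^t\otimes v_b^s+v_b^s\otimes v_a^t& t=s,\ a<b,\end{cases}\qquad (v_a^t\otimes v_b^s)\mathbf E=\begin{cases}v_a^t\otimes v_b^s& t=s,\\ 0& t\ne s,\end{cases}$$ and let $\mathbf G_i,\mathbf E_i$ act on $V^{\otimes n}$ as $\mathbf G,\mathbf E$ in the factors $i,i+1$ and as the identity in the others. Then $g_i\mapsto\mathbf G_i$, $e_i\mapsto\mathbf E_i$ defines a right $\mathcal E_n^{\mathcal K}(q)$-module structure on $V^{\otimes n}$, and this module is faithful. -/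

import Mathlib

open scoped TensorProduct

noncomputable section

namespace BraidsTies

/-! ### Ground rings -/

/-- `∏_{0 ≤ i < j ≤ r - 1} (x ^ i - x ^ j)`. -/
def vandermonde {A : Type*} [CommRing A] (r : ℕ) (x : A) : A :=
  ∏ j ∈ Finset.range r, ∏ i ∈ Finset.range j, (x ^ i - x ^ j)

/-- The complex number `e^{2πi/r}`. -/
def zeta (r : ℕ) : ℂ := Complex.exp (2 * Real.pi * Complex.I / r)

/-- `ℤ[ξ, r⁻¹, Δ⁻¹] ⊆ ℂ`, where `ξ = e^{2πi/r}`. -/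
def scalars (r : ℕ) : Subalgebra ℤ ℂ :=
  Algebra.adjoin ℤ {zeta r, (r : ℂ)⁻¹, (vandermonde r (zeta r))⁻¹}

/-- `ℤ[ξ, r⁻¹, Δ⁻¹]` as a type. -/
def Scalars (r : ℕ) : Type := scalars r

instance instCommRingScalars (r : ℕ) : CommRing (Scalars r) :=
  inferInstanceAs (CommRing (scalars r))

/-- The inclusion `ℤ[ξ, r⁻¹, Δ⁻¹] → ℂ`. -/
def scalarsToComplex (r : ℕ) : Scalars r →+* ℂ := (scalars r).val.toRingHom

theorem scalarsToComplex_injective (r : ℕ) : Function.Injective (scalarsToComplex r) :=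
  Subtype.val_injective

/-- `R = ℤ[q, q⁻¹, ξ, r⁻¹, Δ⁻¹]`. -/
abbrev BaseR (r : ℕ) : Type := LaurentPolynomial (Scalars r)

/-- `S = ℤ[q, q⁻¹]`. -/
abbrev BaseS : Type := LaurentPolynomial ℤ

/-- The element `ξ` of `ℤ[ξ, r⁻¹, Δ⁻¹]`. -/
def scalarXi (r : ℕ) : Scalars r := ⟨zeta r, Algebra.subset_adjoin (by simp)⟩

/-- The element `1 / r` of `ℤ[ξ, r⁻¹, Δ⁻¹]`. -/
def scalarInv (r : ℕ) : Scalars r := ⟨(r : ℂ)⁻¹, Algebra.subset_adjoin (by simp)⟩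

/-- The element `1 / Δ` of `ℤ[ξ, r⁻¹, Δ⁻¹]`. -/
def scalarDeltaInv (r : ℕ) : Scalars r :=
  ⟨(vandermonde r (zeta r))⁻¹, Algebra.subset_adjoin (by simp)⟩

theorem natCast_mul_scalarInv {r : ℕ} (hr : 0 < r) : (r : Scalars r) * scalarInv r = 1 := by
  apply scalarsToComplex_injective r
  rw [map_mul, map_natCast, map_one]
  exact mul_inv_cancel₀ (Nat.cast_ne_zero.2 hr.ne')

/-- The data `(r, ξ)` is admissible for the commutative ring `K`: `ξ` is an `r`-th root of unity in
`K`, and both `r` and `∏_{0 ≤ i < j ≤ r - 1} (ξ ^ i - ξ ^ j)` are invertible in `K`. -/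
structure IsAdmissible {K : Type*} [CommRing K] (r : ℕ) (ξ : Kˣ) : Prop where
  pos : 0 < r
  pow_eq_one : ξ ^ r = 1
  isUnit_natCast : IsUnit (r : K)
  isUnit_vandermonde : IsUnit (vandermonde r (ξ : K))

theorem map_vandermonde {A B : Type*} [CommRing A] [CommRing B] (f : A →+* B) (r : ℕ) (x : A) :
    f (vandermonde r x) = vandermonde r (f x) := by
  simp [vandermonde, map_prod]

theorem vandermonde_zeta_ne_zero {r : ℕ} (hr : 0 < r) : vandermonde r (zeta r) ≠ 0 := by
  refine Finset.prod_ne_zero_iff.2 fun j hj => Finset.prod_ne_zero_iff.2 fun i hi => ?_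
  rw [Finset.mem_range] at hi hj
  intro h
  exact hi.ne ((Complex.isPrimitiveRoot_exp r hr.ne').pow_inj (hi.trans hj) hj (sub_eq_zero.1 h))

theorem eval_cyclotomic_eq_zero {K : Type*} [CommRing K] {r : ℕ} {ξ : Kˣ}
    (h : IsAdmissible r ξ) : (Polynomial.cyclotomic r K).eval (ξ : K) = 0 := by
  have h1 := congrArg (Polynomial.eval (ξ : K))
    (Polynomial.prod_cyclotomic_eq_X_pow_sub_one h.pos K)
  have h2 : (ξ : K) ^ r = 1 := by
    rw [← Units.val_pow_eq_pow_val, h.pow_eq_one, Units.val_one]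
  rw [← Nat.insert_self_properDivisors h.pos.ne'] at h1
  · rw [Finset.prod_insert Nat.self_notMem_properDivisors, Polynomial.eval_mul] at h1
    simp only [Polynomial.eval_sub, Polynomial.eval_pow, Polynomial.eval_X, Polynomial.eval_one,
      h2, sub_self] at h1
    refine (IsUnit.mul_left_eq_zero ?_).1 h1
    rw [Polynomial.eval_prod, IsUnit.prod_iff]
    intro d hd
    rw [Nat.mem_properDivisors] at hd
    have hd0 : 0 < d := Nat.pos_of_dvd_of_pos hd.1 h.pos
    have hdvd : (Polynomial.cyclotomic d K).eval (ξ : K) ∣ (ξ : K) ^ 0 - (ξ : K) ^ d := by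
      obtain ⟨p, hp⟩ := Polynomial.cyclotomic.dvd_X_pow_sub_one d K
      refine ⟨-p.eval (ξ : K), ?_⟩
      have := congrArg (Polynomial.eval (ξ : K)) hp
      simp only [Polynomial.eval_sub, Polynomial.eval_pow, Polynomial.eval_X,
        Polynomial.eval_one, Polynomial.eval_mul] at this
      linear_combination -this
    refine isUnit_of_dvd_unit (hdvd.trans ?_) h.isUnit_vandermonde
    exact (Finset.dvd_prod_of_mem (fun i => (ξ : K) ^ i - (ξ : K) ^ d)
      (Finset.mem_range.2 hd0)).trans
      (Finset.dvd_prod_of_mem (fun j => ∏ i ∈ Finset.range j, ((ξ : K) ^ i - (ξ : K) ^ j))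
        (Finset.mem_range.2 hd.2))

/-- The ring `ℤ[ξ]`, as the quotient `ℤ[X] / (Φ_r)`. -/
abbrev Cyclo (r : ℕ) : Type := AdjoinRoot (Polynomial.cyclotomic r ℤ)

theorem eval_cyclotomic_zeta {r : ℕ} (hr : 0 < r) :
    (Polynomial.cyclotomic r ℤ).eval₂ (Int.castRingHom ℂ) (zeta r) = 0 := by
  rw [Polynomial.eval₂_eq_eval_map, Polynomial.map_cyclotomic_int]
  exact (Complex.isPrimitiveRoot_exp r hr.ne').isRoot_cyclotomic hr

theorem eval_cyclotomic_scalarXi {r : ℕ} (hr : 0 < r) :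
    (Polynomial.cyclotomic r ℤ).eval₂ (Int.castRingHom (Scalars r)) (scalarXi r) = 0 := by
  apply scalarsToComplex_injective r
  rw [Polynomial.hom_eval₂, map_zero, RingHom.eq_intCast' ((scalarsToComplex r).comp _)]
  exact eval_cyclotomic_zeta hr

/-- The inclusion `ℤ[ξ] → ℤ[ξ, r⁻¹, Δ⁻¹]`. -/
def cycloIncl {r : ℕ} (hr : 0 < r) : Cyclo r →+* Scalars r :=
  AdjoinRoot.lift (Int.castRingHom (Scalars r)) (scalarXi r) (eval_cyclotomic_scalarXi hr)

theorem cycloIncl_root {r : ℕ} (hr : 0 < r) :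
    cycloIncl hr (AdjoinRoot.root _) = scalarXi r :=
  AdjoinRoot.lift_root _

theorem cycloIncl_injective {r : ℕ} (hr : 0 < r) : Function.Injective (cycloIncl hr) := by
  rw [injective_iff_map_eq_zero]
  intro x hx
  obtain ⟨p, rfl⟩ := AdjoinRoot.mk_surjective x
  rw [cycloIncl, AdjoinRoot.lift_mk] at hx
  have h1 := congrArg (scalarsToComplex r) hx
  rw [Polynomial.hom_eval₂, map_zero, RingHom.eq_intCast' ((scalarsToComplex r).comp _)] at h1
  rw [AdjoinRoot.mk_eq_zero, Polynomial.cyclotomic_eq_minpoly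
    (Complex.isPrimitiveRoot_exp r hr.ne') hr]
  exact minpoly.isIntegrallyClosed_dvd
    ((Complex.isPrimitiveRoot_exp r hr.ne').isIntegral hr) h1

/-- The element `r Δ` of `ℤ[ξ]`. -/
def cycloDen (r : ℕ) : Cyclo r :=
  (r : Cyclo r) * vandermonde r (AdjoinRoot.root (Polynomial.cyclotomic r ℤ))

theorem toComplex_cycloDen {r : ℕ} (hr : 0 < r) :
    scalarsToComplex r (cycloIncl hr (cycloDen r)) = r * vandermonde r (zeta r) := by
  rw [cycloDen, map_mul, map_mul, map_natCast, map_natCast, map_vandermonde, map_vandermonde,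
    cycloIncl_root]
  rfl

theorem isUnit_cycloIncl_den {r : ℕ} (hr : 0 < r) : IsUnit (cycloIncl hr (cycloDen r)) := by
  have hr0 : (r : ℂ) ≠ 0 := Nat.cast_ne_zero.2 hr.ne'
  have hv := vandermonde_zeta_ne_zero hr
  refine IsUnit.of_mul_eq_one (scalarInv r * scalarDeltaInv r) ?_
  apply scalarsToComplex_injective r
  rw [map_mul, map_mul, toComplex_cycloDen, map_one]
  change r * vandermonde r (zeta r) * ((r : ℂ)⁻¹ * (vandermonde r (zeta r))⁻¹) = 1
  field_simp

theorem exists_mul_pow_eq {r : ℕ} (hr : 0 < r) (z : ℂ) (hz : z ∈ scalars r) :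
    ∃ (a : Cyclo r) (m : ℕ),
      z * ((r : ℂ) * vandermonde r (zeta r)) ^ m = scalarsToComplex r (cycloIncl hr a) := by
  have hr0 : (r : ℂ) ≠ 0 := Nat.cast_ne_zero.2 hr.ne'
  have hv := vandermonde_zeta_ne_zero hr
  have hden := toComplex_cycloDen hr
  induction hz using Algebra.adjoin_induction with
  | mem x hx =>
    rcases hx with rfl | rfl | rfl
    · refine ⟨AdjoinRoot.root _, 0, ?_⟩
      rw [pow_zero, mul_one, cycloIncl_root]
      rfl
    · refine ⟨vandermonde r (AdjoinRoot.root _), 1, ?_⟩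
      rw [map_vandermonde, map_vandermonde, cycloIncl_root, pow_one,
        inv_mul_cancel_left₀ hr0]
      rfl
    · refine ⟨r, 1, ?_⟩
      rw [map_natCast, map_natCast]
      field_simp
  | algebraMap k => exact ⟨k, 0, by simp⟩
  | add x y _ _ hx hy =>
    obtain ⟨a, k, ha⟩ := hx
    obtain ⟨b, l, hb⟩ := hy
    refine ⟨a * cycloDen r ^ l + b * cycloDen r ^ k, k + l, ?_⟩
    simp only [map_add, map_mul, map_pow, hden, ← ha, ← hb]
    ring
  | mul x y _ _ hx hy =>
    obtain ⟨a, k, ha⟩ := hx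
    obtain ⟨b, l, hb⟩ := hy
    refine ⟨a * b, k + l, ?_⟩
    simp only [map_mul, ← ha, ← hb]
    ring

theorem isLocalization_scalars {r : ℕ} (hr : 0 < r) :
    letI := (cycloIncl hr).toAlgebra
    IsLocalization.Away (cycloDen r) (Scalars r) := by
  let := (cycloIncl hr).toAlgebra
  refine (isLocalization_iff _ _).2 ⟨?_, ?_, ?_⟩
  · rintro ⟨_, m, rfl⟩
    change IsUnit (cycloIncl hr (cycloDen r ^ m))
    rw [map_pow]
    exact (isUnit_cycloIncl_den hr).pow m
  · rintro ⟨z, hz⟩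
    obtain ⟨a, m, ham⟩ := exists_mul_pow_eq hr z hz
    refine ⟨(a, ⟨cycloDen r ^ m, m, rfl⟩), scalarsToComplex_injective r ?_⟩
    have key : ∀ w : Scalars r, scalarsToComplex r (w * cycloIncl hr (cycloDen r ^ m)) =
        scalarsToComplex r w * ((r : ℂ) * vandermonde r (zeta r)) ^ m := fun w => by
      rw [map_mul, map_pow, map_pow, toComplex_cycloDen]
    exact (key ⟨z, hz⟩).trans ham
  · intro x y hxy
    exact ⟨1, by rw [cycloIncl_injective hr hxy]⟩

/-- The ring homomorphism `ℤ[ξ] → K` sending `ξ` to `ξ`. -/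
def cycloHom {K : Type*} [CommRing K] {r : ℕ} {ξ : Kˣ} (h : IsAdmissible r ξ) :
    Cyclo r →+* K :=
  AdjoinRoot.lift (Int.castRingHom K) (ξ : K) (by
    rw [Polynomial.eval₂_eq_eval_map, Polynomial.map_cyclotomic_int]
    exact eval_cyclotomic_eq_zero h)

theorem cycloHom_root {K : Type*} [CommRing K] {r : ℕ} {ξ : Kˣ} (h : IsAdmissible r ξ) :
    cycloHom h (AdjoinRoot.root _) = ξ :=
  AdjoinRoot.lift_root _

theorem isUnit_cycloHom_den {K : Type*} [CommRing K] {r : ℕ} {ξ : Kˣ} (h : IsAdmissible r ξ) :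
    IsUnit (cycloHom h (cycloDen r)) := by
  rw [cycloDen, map_mul, map_natCast, map_vandermonde, cycloHom_root]
  exact h.isUnit_natCast.mul h.isUnit_vandermonde

/-- The ring homomorphism `ℤ[ξ, r⁻¹, Δ⁻¹] → K` sending `ξ` to `ξ`. -/
def scalarHom {K : Type*} [CommRing K] {r : ℕ} {ξ : Kˣ} (h : IsAdmissible r ξ) :
    Scalars r →+* K :=
  letI := (cycloIncl h.pos).toAlgebra
  haveI := isLocalization_scalars h.pos
  IsLocalization.Away.lift (cycloDen r) (isUnit_cycloHom_den h)

theorem scalarHom_xi {K : Type*} [CommRing K] {r : ℕ} {ξ : Kˣ} (h : IsAdmissible r ξ) :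
    scalarHom h (scalarXi r) = ξ := by
  let := (cycloIncl h.pos).toAlgebra
  have := isLocalization_scalars h.pos
  have h1 := IsLocalization.Away.lift_eq (S := Scalars r) (cycloDen r) (isUnit_cycloHom_den h)
    (AdjoinRoot.root _)
  rw [cycloHom_root] at h1
  rw [← cycloIncl_root h.pos]
  exact h1

/-- The specialization `R → K` sending `q` to `q` and `ξ` to `ξ`. -/
def specializeR {K : Type*} [CommRing K] {r : ℕ} {ξ : Kˣ} (h : IsAdmissible r ξ) (q : Kˣ) :
    BaseR r →+* K :=
  LaurentPolynomial.eval₂ (scalarHom h) q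

/-- The specialization `S → K` sending `q` to `q`. -/
def specializeS {K : Type*} [CommRing K] (q : Kˣ) : BaseS →+* K :=
  LaurentPolynomial.eval₂ (Int.castRingHom K) q

theorem specializeR_q {K : Type*} [CommRing K] {r : ℕ} {ξ : Kˣ} (h : IsAdmissible r ξ) (q : Kˣ) :
    specializeR h q (LaurentPolynomial.T 1) = q := by
  rw [specializeR, LaurentPolynomial.eval₂_T, zpow_one]

theorem specializeR_xi {K : Type*} [CommRing K] {r : ℕ} {ξ : Kˣ} (h : IsAdmissible r ξ) (q : Kˣ) :
    specializeR h q (LaurentPolynomial.C (scalarXi r)) = ξ := by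
  rw [specializeR, LaurentPolynomial.eval₂_C, scalarHom_xi]

theorem specializeS_q {K : Type*} [CommRing K] (q : Kˣ) :
    specializeS q (LaurentPolynomial.T 1) = q := by
  rw [specializeS, LaurentPolynomial.eval₂_T, zpow_one]

/-! ### Base change -/

/-- The base change `B ⊗_A K` of an `A`-algebra `B` along a ring homomorphism `f : A → K`; the
scalars are written on the left. -/
def BaseChange {A K : Type*} [CommRing A] [CommRing K] (f : A →+* K) (B : Type*) [Ring B]
    [Algebra A B] : Type _ :=
  letI : Algebra A K := f.toAlgebra
  K ⊗[A] B

namespace BaseChange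

variable {A K : Type*} [CommRing A] [CommRing K] (f : A →+* K) (B : Type*) [Ring B] [Algebra A B]

instance instRing : Ring (BaseChange f B) :=
  letI : Algebra A K := f.toAlgebra
  (inferInstance : Ring (K ⊗[A] B))

instance instAlgebra : Algebra K (BaseChange f B) :=
  letI : Algebra A K := f.toAlgebra
  (inferInstance : Algebra K (K ⊗[A] B))

variable {B}

/-- The image `b ⊗ 1` of an element `b` of `B`. -/
def of (b : B) : BaseChange f B :=
  letI : Algebra A K := f.toAlgebra
  ((1 : K) ⊗ₜ[A] b : K ⊗[A] B)

end BaseChange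

/-! ### Indices

Letters `1, …, n` are modelled by `Fin n` and the indices `1, …, n - 1` by `Fin (n - 1)`. -/

/-- The letter `i`, for an index `i` in `1, …, n - 1`. -/
def lo {n : ℕ} (i : Fin (n - 1)) : Fin n := ⟨i, by omega⟩

/-- The letter `i + 1`, for an index `i` in `1, …, n - 1`. -/
def hi {n : ℕ} (i : Fin (n - 1)) : Fin n := ⟨i + 1, by omega⟩

/-- The simple transposition `s_i = (i, i + 1)`. -/
def simple {n : ℕ} (i : Fin (n - 1)) : Equiv.Perm (Fin n) := Equiv.swap (lo i) (hi i)

/-- `|i - j| > 1`. -/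
def Far {m : ℕ} (i j : Fin m) : Prop := i.val + 1 < j.val ∨ j.val + 1 < i.val

/-- `|i - j| = 1`. -/
def Near {m : ℕ} (i j : Fin m) : Prop := i.val + 1 = j.val ∨ j.val + 1 = i.val

/-! ### The Yokonuma-Hecke algebra -/

/-- Generators `g_1, …, g_{n-1}, t_1, …, t_n`. -/
inductive YGen (n : ℕ) : Type
  | g (i : Fin (n - 1))
  | t (j : Fin n)

/-- The generator `g_i` in the free `R`-algebra. -/
def yg (r : ℕ) {n : ℕ} (i : Fin (n - 1)) : FreeAlgebra (BaseR r) (YGen n) :=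
  FreeAlgebra.ι _ (YGen.g i)

/-- The generator `t_j` in the free `R`-algebra. -/
def yt (r : ℕ) {n : ℕ} (j : Fin n) : FreeAlgebra (BaseR r) (YGen n) :=
  FreeAlgebra.ι _ (YGen.t j)

/-- `e_i = (1 / r) ∑_{s = 0}^{r - 1} t_i ^ s t_{i+1} ^ {-s}`; since `t_{i+1} ^ r = 1`, the power
`t_{i+1} ^ {-s}` is written `t_{i+1} ^ (r - s)`. -/
def ye (r : ℕ) {n : ℕ} (i : Fin (n - 1)) : FreeAlgebra (BaseR r) (YGen n) :=
  (LaurentPolynomial.C (scalarInv r) : BaseR r) •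
    ∑ s ∈ Finset.range r, yt r (lo i) ^ s * yt r (hi i) ^ (r - s)

/-- The defining relations of the Yokonuma-Hecke algebra. -/
inductive YRel (r n : ℕ) :
    FreeAlgebra (BaseR r) (YGen n) → FreeAlgebra (BaseR r) (YGen n) → Prop
  | t_pow (i : Fin n) : YRel r n (yt r i ^ r) 1
  | t_comm (i j : Fin n) : YRel r n (yt r i * yt r j) (yt r j * yt r i)
  | t_g (i : Fin (n - 1)) (j : Fin n) :
      YRel r n (yt r j * yg r i) (yg r i * yt r (simple i j))
  | g_comm (i j : Fin (n - 1)) (h : Far i j) : YRel r n (yg r i * yg r j) (yg r j * yg r i)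
  | g_braid (i j : Fin (n - 1)) (h : i.val + 1 = j.val) :
      YRel r n (yg r i * yg r j * yg r i) (yg r j * yg r i * yg r j)
  | g_quad (i : Fin (n - 1)) :
      YRel r n (yg r i ^ 2)
        (1 + (LaurentPolynomial.T 1 - LaurentPolynomial.T (-1) : BaseR r) • (ye r i * yg r i))

/-- The Yokonuma-Hecke algebra `Y_{r,n}(q)` over `R`. -/
abbrev YokonumaHecke (r n : ℕ) : Type := RingQuot (YRel r n)

namespace YokonumaHecke

/-- The element `g_i` of `Y_{r,n}(q)`. -/
def g (r : ℕ) {n : ℕ} (i : Fin (n - 1)) : YokonumaHecke r n :=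
  RingQuot.mkAlgHom (BaseR r) (YRel r n) (yg r i)

/-- The element `t_j` of `Y_{r,n}(q)`. -/
def t (r : ℕ) {n : ℕ} (j : Fin n) : YokonumaHecke r n :=
  RingQuot.mkAlgHom (BaseR r) (YRel r n) (yt r j)

/-- The element `e_i = (1 / r) ∑_s t_i ^ s t_{i+1} ^ {-s}` of `Y_{r,n}(q)`. -/
def e (r : ℕ) {n : ℕ} (i : Fin (n - 1)) : YokonumaHecke r n :=
  RingQuot.mkAlgHom (BaseR r) (YRel r n) (ye r i)

end YokonumaHecke

/-- The specialized algebra `Y_{r,n}^K(q) = Y_{r,n}(q) ⊗_R K`. -/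
abbrev YokonumaHeckeK {K : Type*} [CommRing K] {r : ℕ} (n : ℕ) {ξ : Kˣ} (h : IsAdmissible r ξ)
    (q : Kˣ) : Type _ :=
  BaseChange (specializeR h q) (YokonumaHecke r n)

namespace YokonumaHeckeK

variable {K : Type*} [CommRing K] {r : ℕ} {n : ℕ} {ξ : Kˣ} (h : IsAdmissible r ξ) (q : Kˣ)

/-- The element `g_i` of `Y_{r,n}^K(q)`. -/
def g (i : Fin (n - 1)) : YokonumaHeckeK n h q := BaseChange.of _ (YokonumaHecke.g r i)

/-- The element `e_i` of `Y_{r,n}^K(q)`. -/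
def e (i : Fin (n - 1)) : YokonumaHeckeK n h q := BaseChange.of _ (YokonumaHecke.e r i)

end YokonumaHeckeK

/-! ### The algebra of braids and ties -/

/-- Generators `g_1, …, g_{n-1}, e_1, …, e_{n-1}`. -/
inductive EGen (n : ℕ) : Type
  | g (i : Fin (n - 1))
  | e (i : Fin (n - 1))

/-- The generator `g_i` in the free `S`-algebra. -/
def eg {n : ℕ} (i : Fin (n - 1)) : FreeAlgebra BaseS (EGen n) := FreeAlgebra.ι _ (EGen.g i)

/-- The generator `e_i` in the free `S`-algebra. -/
def ee {n : ℕ} (i : Fin (n - 1)) : FreeAlgebra BaseS (EGen n) := FreeAlgebra.ι _ (EGen.e i)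

/-- The defining relations of the algebra of braids and ties. -/
inductive ERel (n : ℕ) : FreeAlgebra BaseS (EGen n) → FreeAlgebra BaseS (EGen n) → Prop
  | gg_far (i j : Fin (n - 1)) (h : Far i j) : ERel n (eg i * eg j) (eg j * eg i)
  | ge_same (i : Fin (n - 1)) : ERel n (eg i * ee i) (ee i * eg i)
  | braid (i j : Fin (n - 1)) (h : Near i j) : ERel n (eg i * eg j * eg i) (eg j * eg i * eg j)
  | egg (i j : Fin (n - 1)) (h : Near i j) : ERel n (ee i * eg j * eg i) (eg j * eg i * ee j)
  | eeg_left (i j : Fin (n - 1)) (h : Near i j) :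
      ERel n (ee i * ee j * eg j) (ee i * eg j * ee i)
  | eeg_right (i j : Fin (n - 1)) (h : Near i j) :
      ERel n (ee i * eg j * ee i) (eg j * ee i * ee j)
  | ee_comm (i j : Fin (n - 1)) : ERel n (ee i * ee j) (ee j * ee i)
  | ge_far (i j : Fin (n - 1)) (h : Far i j) : ERel n (eg i * ee j) (ee j * eg i)
  | e_sq (i : Fin (n - 1)) : ERel n (ee i ^ 2) (ee i)
  | g_quad (i : Fin (n - 1)) :
      ERel n (eg i ^ 2)
        (1 + (LaurentPolynomial.T 1 - LaurentPolynomial.T (-1) : BaseS) • (ee i * eg i))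

/-- The algebra of braids and ties `E_n(q)` over `S`. -/
abbrev BraidTie (n : ℕ) : Type := RingQuot (ERel n)

namespace BraidTie

/-- The element `g_i` of `E_n(q)`. -/
def g {n : ℕ} (i : Fin (n - 1)) : BraidTie n := RingQuot.mkAlgHom BaseS (ERel n) (eg i)

/-- The element `e_i` of `E_n(q)`. -/
def e {n : ℕ} (i : Fin (n - 1)) : BraidTie n := RingQuot.mkAlgHom BaseS (ERel n) (ee i)

end BraidTie

/-- The specialized algebra `E_n^K(q) = E_n(q) ⊗_S K`. -/
abbrev BraidTieK {K : Type*} [CommRing K] (n : ℕ) (q : Kˣ) : Type _ :=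
  BaseChange (specializeS q) (BraidTie n)

namespace BraidTieK

variable {K : Type*} [CommRing K] {n : ℕ} (q : Kˣ)

/-- The element `g_i` of `E_n^K(q)`. -/
def g (i : Fin (n - 1)) : BraidTieK n q := BaseChange.of _ (BraidTie.g i)

/-- The element `e_i` of `E_n^K(q)`. -/
def e (i : Fin (n - 1)) : BraidTieK n q := BaseChange.of _ (BraidTie.e i)

end BraidTieK

/-! ### The tensor space -/

/-- The free `K`-module `V` with basis `v_i^t`, `1 ≤ i ≤ n`, `0 ≤ t ≤ r - 1`; the basis vector
`v_i^t` has index `(i, t)`. -/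
abbrev V (K : Type*) [CommRing K] (r n : ℕ) : Type _ := (Fin n × Fin r) →₀ K

/-- The tensor space `V^{⊗ n}`. -/
abbrev TensorSpace (K : Type*) [CommRing K] (r n : ℕ) : Type _ :=
  PiTensorProduct K (fun _ : Fin n => V K r n)

/-- The basis `v_{i_1}^{t_1} ⊗ ⋯ ⊗ v_{i_n}^{t_n}` of `V^{⊗ n}`, indexed by
`k ↦ (i_k, t_k)`. -/
def tensorBasis (K : Type*) [CommRing K] (r n : ℕ) :
    Module.Basis (Fin n → Fin n × Fin r) K (TensorSpace K r n) :=
  Basis.piTensorProduct fun _ => Finsupp.basisSingleOne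

theorem tensorBasis_apply (K : Type*) [CommRing K] (r n : ℕ) (f : Fin n → Fin n × Fin r) :
    tensorBasis K r n f = PiTensorProduct.tprod K fun k => Finsupp.single (f k) (1 : K) := by
  simp [tensorBasis, Basis.piTensorProduct_apply]

/-- The operator `𝐆_i` on `V^{⊗ n}`: in the factors `i`, `i + 1` it sends `v_a^t ⊗ v_b^s` to
`v_b^s ⊗ v_a^t` if `t ≠ s`, to `q v_a^t ⊗ v_b^s` if `t = s` and `a = b`, to `v_b^s ⊗ v_a^t` if
`t = s` and `a > b`, and to `(q - q⁻¹) v_a^t ⊗ v_b^s + v_b^s ⊗ v_a^t` if `t = s` and `a < b`. -/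
def opG {K : Type*} [CommRing K] (r : ℕ) {n : ℕ} (q : Kˣ) (i : Fin (n - 1)) :
    Module.End K (TensorSpace K r n) :=
  (tensorBasis K r n).constr K fun f =>
    if (f (lo i)).2 ≠ (f (hi i)).2 then tensorBasis K r n (f ∘ simple i)
    else if (f (lo i)).1 = (f (hi i)).1 then (q : K) • tensorBasis K r n f
    else if (f (lo i)).1 > (f (hi i)).1 then tensorBasis K r n (f ∘ simple i)
    else ((q : K) - (q⁻¹ : Kˣ)) • tensorBasis K r n f + tensorBasis K r n (f ∘ simple i)

/-- The operator `𝐄_i` on `V^{⊗ n}`: in the factors `i`, `i + 1` it sends `v_a^t ⊗ v_b^s` to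
itself if `t = s` and to `0` if `t ≠ s`. -/
def opE (K : Type*) [CommRing K] (r : ℕ) {n : ℕ} (i : Fin (n - 1)) :
    Module.End K (TensorSpace K r n) :=
  (tensorBasis K r n).constr K fun f =>
    if (f (lo i)).2 = (f (hi i)).2 then tensorBasis K r n f else 0

end BraidsTies

end

/-!
# Faithful representations of the algebra of braids and ties

Both assertions come down to the faithfulness of the tensor space. The Yokonuma-Hecke algebra also
acts on `V^{⊗ n}`, with `t_j` multiplying `v_a^s` in the factor `j` by `ξ ^ s`; invertibility of `r`
and of the differences `ξ ^ i - ξ ^ j` makes the idempotent `(1 / r) ∑ t_i ^ s t_{i+1} ^ {-s}` act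
as `𝐄_i` (`yTie_op_opT`). The action of `E_n^K(q)` therefore factors through `φ`, and `φ` is
injective as soon as the tensor space is faithful.

Relations are transported through the notion `IsTieSystem`: ties `e_{ab}` between any two letters,
permuted by the `g_i` and multiplying like set partitions under the join. Such a system yields the
relations of braids and ties (`IsTieSystem.isBraidTie`); the Yokonuma-Hecke algebra
(`IsYokonuma.isTieSystem`) and the operators on the tensor space (`isTieSystem_op`) provide one.
Conversely, in `E_n^K(q)` the ties `e_{ab}` are the conjugates of the `e_i` under products of the
`g_k`. They are well defined because each `g_k ^ 2` commutes with all of them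
(`IsBraidAction.smul_tieBetween`), and their relations follow from those between the `e_i` by moving
the letters involved to the first positions (`IsBraidTie.isTieSystem`).

Faithfulness compares a spanning set with its image. The products `p g_w` span `E_n^K(q)`
(`BraidTieK.mem_normalSpan`), where `p` is a product of ties and `g_w` a normal form, that is a
product `D_1 ⋯ D_{n-1}` with `D_j = g_j g_{j-1} ⋯ g_k`; a normal form is determined by its
permutation `w` (`normalForms_snd_injOn`). On a basis vector `v` whose lower indices decrease,
`g_w` only permutes the factors (`normalForm_tensorBasis`), and `p` fixes or kills `v` according to
whether its partition refines the partition of the factors by upper index. As `r ≥ n`, every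
partition arises from upper indices, so a linear relation between the operators `p g_w` is
triangular with respect to refinement and has to be trivial (`linearIndependent_of_isTieSystem`).
The argument works over every commutative ring.
-/

noncomputable section

namespace BraidsTies

/-! ### Base changes of presented algebras -/

namespace BaseChange

variable {A K : Type*} [CommRing A] [CommRing K] (f : A →+* K) {B : Type*} [Ring B] [Algebra A B]
  {C : Type*} [Semiring C] [Algebra K C]

/-- The ring homomorphism `b ↦ b ⊗ 1`. -/
def ofHom : B →+* BaseChange f B :=
  letI : Algebra A K := f.toAlgebra
  (Algebra.TensorProduct.includeRight : B →ₐ[A] K ⊗[A] B).toRingHom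

theorem of_smul (a : A) (b : B) : of f (a • b) = f a • of f b := by
  let : Algebra A K := f.toAlgebra
  change (1 : K) ⊗ₜ[A] (a • b) = f a • ((1 : K) ⊗ₜ[A] b)
  rw [TensorProduct.smul_tmul', ← TensorProduct.smul_tmul, Algebra.smul_def, smul_eq_mul]
  rfl

variable {f}

/-- The homomorphism out of a base change given by a ring homomorphism that is semilinear over
the change of scalars. -/
def lift (g : B →+* C) (hg : ∀ a, g (algebraMap A B a) = algebraMap K C (f a)) :
    BaseChange f B →ₐ[K] C :=
  letI : Algebra A K := f.toAlgebra
  letI : Algebra A C := Algebra.compHom C f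
  haveI : IsScalarTower A K C := IsScalarTower.of_algebraMap_eq fun _ => rfl
  let g' : B →ₐ[A] C := { g with commutes' := hg }
  (Algebra.TensorProduct.lift (Algebra.ofId K C) g' fun x y => Algebra.commutes x (g' y) :
    K ⊗[A] B →ₐ[K] C)

theorem lift_of (g : B →+* C) (hg : ∀ a, g (algebraMap A B a) = algebraMap K C (f a)) (b : B) :
    lift g hg (of f b) = g b := by
  let : Algebra A K := f.toAlgebra
  let : Algebra A C := Algebra.compHom C f
  have : IsScalarTower A K C := IsScalarTower.of_algebraMap_eq fun _ => rfl
  let g' : B →ₐ[A] C := { g with commutes' := hg }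
  have h := Algebra.TensorProduct.lift_tmul (S := K) (Algebra.ofId K C) g'
    (fun x y => Algebra.commutes x (g' y)) 1 b
  refine h.trans ?_
  rw [map_one, one_mul]
  rfl

theorem algHom_ext {φ ψ : BaseChange f B →ₐ[K] C} (h : ∀ b, φ (of f b) = ψ (of f b)) :
    φ = ψ := by
  let : Algebra A K := f.toAlgebra
  refine AlgHom.ext fun x => ?_
  induction x using TensorProduct.induction_on with
  | zero => exact (map_zero φ).trans (map_zero ψ).symm
  | tmul k b =>
    have : (k ⊗ₜ[A] b : K ⊗[A] B) = k • ((1 : K) ⊗ₜ[A] b) := by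
      rw [TensorProduct.smul_tmul', smul_eq_mul, mul_one]
    rw [this]
    exact (map_smul φ k (of f b)).trans ((congrArg (k • ·) (h b)).trans
      (map_smul ψ k (of f b)).symm)
  | add x y hx hy => exact (map_add φ x y).trans ((congrArg₂ (· + ·) hx hy).trans
      (map_add ψ x y).symm)

variable (f) in
/-- Evaluation of noncommutative polynomials over `A` at a family of elements of a `K`-algebra. -/
def eval {X : Type*} (v : X → C) : FreeAlgebra A X →+* C :=
  letI : Algebra A C := Algebra.compHom C f
  (FreeAlgebra.lift A v).toRingHom

theorem eval_ι {X : Type*} (v : X → C) (x : X) : eval f v (FreeAlgebra.ι A x) = v x := by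
  let : Algebra A C := Algebra.compHom C f
  exact FreeAlgebra.lift_ι_apply v x

theorem eval_algebraMap {X : Type*} (v : X → C) (a : A) :
    eval f v (algebraMap A _ a) = algebraMap K C (f a) := by
  let : Algebra A C := Algebra.compHom C f
  exact (FreeAlgebra.lift A v).commutes a

theorem eval_smul {X : Type*} (v : X → C) (a : A) (x : FreeAlgebra A X) :
    eval f v (a • x) = f a • eval f v x := by
  rw [Algebra.smul_def, map_mul, eval_algebraMap, Algebra.smul_def]

variable (f) in
/-- The image of a noncommutative polynomial in the base change of a presented algebra. -/
def mk {X : Type*} (rel : FreeAlgebra A X → FreeAlgebra A X → Prop) :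
    FreeAlgebra A X →+* BaseChange f (RingQuot rel) :=
  (ofHom f).comp (RingQuot.mkAlgHom A rel).toRingHom

theorem mk_rel {X : Type*} {rel : FreeAlgebra A X → FreeAlgebra A X → Prop}
    {x y : FreeAlgebra A X} (h : rel x y) : mk f rel x = mk f rel y :=
  congrArg (of f) (RingQuot.mkAlgHom_rel A h)

theorem mk_smul {X : Type*} (rel : FreeAlgebra A X → FreeAlgebra A X → Prop) (a : A)
    (x : FreeAlgebra A X) : mk f rel (a • x) = f a • mk f rel x :=
  (congrArg (of f) (map_smul (RingQuot.mkAlgHom A rel) a x)).trans (of_smul f a _)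

/-- The universal property of the base change of a presented algebra. -/
theorem exists_algHom_mk_eq_eval {X : Type*} {rel : FreeAlgebra A X → FreeAlgebra A X → Prop}
    (v : X → C) (hv : ∀ ⦃x y⦄, rel x y → eval f v x = eval f v y) :
    ∃ φ : BaseChange f (RingQuot rel) →ₐ[K] C, ∀ x, φ (mk f rel x) = eval f v x := by
  let : Algebra A C := Algebra.compHom C f
  refine ⟨lift (RingQuot.liftAlgHom A ⟨FreeAlgebra.lift A v, hv⟩).toRingHom
    fun a => (RingQuot.liftAlgHom A ⟨FreeAlgebra.lift A v, hv⟩).commutes a, fun x => ?_⟩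
  refine (lift_of _ _ _).trans ?_
  exact RingQuot.liftAlgHom_mkAlgHom_apply A (FreeAlgebra.lift A v) hv x

theorem algHom_ext_mk {X : Type*} {rel : FreeAlgebra A X → FreeAlgebra A X → Prop}
    {φ ψ : BaseChange f (RingQuot rel) →ₐ[K] C}
    (h : ∀ x, φ (mk f rel (FreeAlgebra.ι A x)) = ψ (mk f rel (FreeAlgebra.ι A x))) : φ = ψ := by
  let : Algebra A C := Algebra.compHom C f
  let F (χ : BaseChange f (RingQuot rel) →ₐ[K] C) : RingQuot rel →ₐ[A] C :=
    { χ.toRingHom.comp (ofHom f) with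
      commutes' := fun a => by
        change χ (of f (algebraMap A _ a)) = algebraMap K C (f a)
        have h1 : of f (1 : RingQuot rel) = 1 := map_one (ofHom f)
        rw [Algebra.algebraMap_eq_smul_one, of_smul, map_smul, h1, map_one,
          Algebra.algebraMap_eq_smul_one] }
  have hF : F φ = F ψ := by
    refine RingQuot.ringQuot_ext' A _ _ (FreeAlgebra.hom_ext (funext fun x => h x))
  exact algHom_ext fun b => DFunLike.congr_fun hF b

end BaseChange

/-! ### The relations of braids and ties in an arbitrary algebra -/

section Relations

variable {K : Type*} [CommRing K] {n : ℕ}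

/-- Elements `g_i`, `e_i` of a `K`-algebra satisfy the relations of the algebra of braids and
ties. -/
structure IsBraidTie {A : Type*} [Semiring A] [Algebra K A] (q : Kˣ) (g e : Fin (n - 1) → A) :
    Prop where
  gg_far : ∀ i j, Far i j → g i * g j = g j * g i
  ge_same : ∀ i, g i * e i = e i * g i
  braid : ∀ i j, Near i j → g i * g j * g i = g j * g i * g j
  egg : ∀ i j, Near i j → e i * g j * g i = g j * g i * e j
  eeg_left : ∀ i j, Near i j → e i * e j * g j = e i * g j * e i
  eeg_right : ∀ i j, Near i j → e i * g j * e i = g j * e i * e j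
  ee_comm : ∀ i j, e i * e j = e j * e i
  ge_far : ∀ i j, Far i j → g i * e j = e j * g i
  e_sq : ∀ i, e i ^ 2 = e i
  g_quad : ∀ i, g i ^ 2 = 1 + ((q : K) - (q⁻¹ : Kˣ)) • (e i * g i)

variable {A : Type*} [Semiring A] [Algebra K A] (q : Kˣ)

theorem specializeS_q_sub :
    specializeS q (LaurentPolynomial.T 1 - LaurentPolynomial.T (-1)) =
      (q : K) - (q⁻¹ : Kˣ) := by
  rw [map_sub, specializeS_q, specializeS, LaurentPolynomial.eval₂_T, zpow_neg_one]

theorem BraidTieK.isBraidTie :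
    IsBraidTie q (BraidTieK.g q : Fin (n - 1) → BraidTieK n q) (BraidTieK.e q) := by
  have hq : ∀ x, BaseChange.mk (specializeS q) (ERel n)
      ((LaurentPolynomial.T 1 - LaurentPolynomial.T (-1) : BaseS) • x) =
      ((q : K) - (q⁻¹ : Kˣ)) • BaseChange.mk (specializeS q) (ERel n) x := fun x => by
    rw [BaseChange.mk_smul, specializeS_q_sub]
  have hg : ∀ i : Fin (n - 1),
    BraidTieK.g q i = BaseChange.mk (specializeS q) (ERel n) (eg i) := fun _ => rfl
  have he : ∀ i : Fin (n - 1),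
    BraidTieK.e q i = BaseChange.mk (specializeS q) (ERel n) (ee i) := fun _ => rfl
  constructor <;> intros <;>
    simp only [hg, he, ← map_mul, ← map_pow, ← hq, ← map_one (BaseChange.mk (specializeS q) _),
      ← map_add] <;>
    refine BaseChange.mk_rel ?_ <;> constructor <;> assumption

/-- The universal property of `E_n^K(q)`. -/
theorem IsBraidTie.exists_algHom {q : Kˣ} {g e : Fin (n - 1) → A} (h : IsBraidTie q g e) :
    ∃ φ : BraidTieK n q →ₐ[K] A,
      ∀ i, φ (BraidTieK.g q i) = g i ∧ φ (BraidTieK.e q i) = e i := by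
  let v : EGen n → A := fun x => match x with
    | EGen.g i => g i
    | EGen.e i => e i
  have hg : ∀ i : Fin (n - 1), BaseChange.eval (specializeS q) v (eg i) = g i :=
    fun i => BaseChange.eval_ι v (EGen.g i)
  have he : ∀ i : Fin (n - 1), BaseChange.eval (specializeS q) v (ee i) = e i :=
    fun i => BaseChange.eval_ι v (EGen.e i)
  obtain ⟨φ, hφ⟩ := BaseChange.exists_algHom_mk_eq_eval (f := specializeS q) (rel := ERel n) v (by
    intro x y hxy
    cases hxy <;>
      simp only [map_mul, map_pow, map_add, map_one, BaseChange.eval_smul, specializeS_q_sub,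
        hg, he]
    · exact h.gg_far _ _ ‹_›
    · exact h.ge_same _
    · exact h.braid _ _ ‹_›
    · exact h.egg _ _ ‹_›
    · exact h.eeg_left _ _ ‹_›
    · exact h.eeg_right _ _ ‹_›
    · exact h.ee_comm _ _
    · exact h.ge_far _ _ ‹_›
    · exact h.e_sq _
    · exact h.g_quad _)
  exact ⟨φ, fun i => ⟨(hφ (eg i)).trans (hg i), (hφ (ee i)).trans (he i)⟩⟩

variable {q}

theorem BraidTieK.algHom_ext {φ ψ : BraidTieK n q →ₐ[K] A}
    (hg : ∀ i, φ (BraidTieK.g q i) = ψ (BraidTieK.g q i))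
    (he : ∀ i, φ (BraidTieK.e q i) = ψ (BraidTieK.e q i)) : φ = ψ :=
  BaseChange.algHom_ext_mk fun x => match x with
    | EGen.g i => hg i
    | EGen.e i => he i

theorem IsBraidTie.of_injective {B : Type*} [Semiring B] [Algebra K B] {g e : Fin (n - 1) → B}
    (f : B →ₐ[K] A) (hf : Function.Injective f) (h : IsBraidTie q (f ∘ g) (f ∘ e)) :
    IsBraidTie q g e := by
  constructor <;> intros <;> apply hf <;>
    simp only [map_mul, map_pow, map_add, map_one, map_smul]
  · exact h.gg_far _ _ ‹_›
  · exact h.ge_same _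
  · exact h.braid _ _ ‹_›
  · exact h.egg _ _ ‹_›
  · exact h.eeg_left _ _ ‹_›
  · exact h.eeg_right _ _ ‹_›
  · exact h.ee_comm _ _
  · exact h.ge_far _ _ ‹_›
  · exact h.e_sq _
  · exact h.g_quad _

/-- `E_n^K(q)` is generated as an algebra by the `g_i` and `e_i`. -/
theorem BraidTieK.mem_of_forall_mem (S : Subalgebra K (BraidTieK n q))
    (hg : ∀ i, BraidTieK.g q i ∈ S) (he : ∀ i, BraidTieK.e q i ∈ S) (x : BraidTieK n q) :
    x ∈ S := by
  have h : IsBraidTie q (fun i : Fin (n - 1) => (⟨BraidTieK.g q i, hg i⟩ : S))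
      (fun i => ⟨BraidTieK.e q i, he i⟩) :=
    IsBraidTie.of_injective S.val Subtype.val_injective (BraidTieK.isBraidTie q)
  obtain ⟨φ, hφ⟩ := h.exists_algHom
  have h1 : S.val.comp φ = AlgHom.id K _ :=
    BraidTieK.algHom_ext (fun i => congrArg S.val (hφ i).1) fun i => congrArg S.val (hφ i).2
  have h2 := DFunLike.congr_fun h1 x
  change ((φ x : S) : BraidTieK n q) = x at h2
  exact h2 ▸ (φ x).2

end Relations

/-! ### Systems of ties -/

section TieSystem

variable {K : Type*} [CommRing K] {n : ℕ} {A : Type*} [Semiring A] [Algebra K A]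

/-- Elements `g_i` of a `K`-algebra together with ties `e_{ab}` between any two letters, which are
permuted by the `g_i` and multiply like the partitions of the set of letters under the join. -/
structure IsTieSystem (q : Kˣ) (g : Fin (n - 1) → A) (e : Fin n → Fin n → A) : Prop where
  g_far : ∀ i j, Far i j → g i * g j = g j * g i
  g_braid : ∀ i j : Fin (n - 1), i.val + 1 = j.val → g i * g j * g i = g j * g i * g j
  g_quad : ∀ i, g i ^ 2 = 1 + ((q : K) - (q⁻¹ : Kˣ)) • (e (lo i) (hi i) * g i)
  g_e : ∀ i a b, g i * e a b = e (simple i a) (simple i b) * g i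
  e_self : ∀ a, e a a = 1
  e_symm : ∀ a b, e a b = e b a
  e_comm : ∀ a b c d, e a b * e c d = e c d * e a b
  e_idem : ∀ a b, e a b * e a b = e a b
  e_trans : ∀ a b c, e a b * e b c = e a b * e a c

theorem lo_ne_hi (i : Fin (n - 1)) : lo i ≠ hi i := by
  simp [lo, hi, Fin.ext_iff]

theorem simple_lo (i : Fin (n - 1)) : simple i (lo i) = hi i := Equiv.swap_apply_left _ _

theorem simple_hi (i : Fin (n - 1)) : simple i (hi i) = lo i := Equiv.swap_apply_right _ _

theorem simple_simple (i : Fin (n - 1)) (a : Fin n) : simple i (simple i a) = a :=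
  Equiv.swap_apply_self _ _ _

theorem hi_eq_lo {i j : Fin (n - 1)} (h : i.val + 1 = j.val) : hi i = lo j := Fin.ext h

theorem simple_of_ne {i : Fin (n - 1)} {a : Fin n} (h1 : a.val ≠ i.val) (h2 : a.val ≠ i.val + 1) :
    simple i a = a :=
  Equiv.swap_apply_of_ne_of_ne (fun h => h1 (congrArg Fin.val h)) fun h => h2 (congrArg Fin.val h)

theorem simple_val (i : Fin (n - 1)) (a : Fin n) :
    (simple i a).val = if a.val = i.val then i.val + 1 else if a.val = i.val + 1 then i.val
      else a.val := by
  split_ifs with h1 h2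
  · rw [show a = lo i from Fin.ext h1, simple_lo]; rfl
  · rw [show a = hi i from Fin.ext h2, simple_hi]; rfl
  · rw [simple_of_ne h1 h2]

namespace IsTieSystem

variable {q : Kˣ} {g : Fin (n - 1) → A} {e : Fin n → Fin n → A} (h : IsTieSystem q g e)
include h

/-- The ties between neighbouring letters satisfy the relations of the algebra of braids and
ties. -/
theorem isBraidTie : IsBraidTie q g fun i => e (lo i) (hi i) where
  gg_far := h.g_far
  ge_same i := by rw [h.g_e, simple_lo, simple_hi, h.e_symm]
  braid i j hij := hij.elim (h.g_braid i j) fun hji => (h.g_braid j i hji).symm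
  egg i j hij := by
    rw [mul_assoc (g j), h.g_e, ← mul_assoc, h.g_e, mul_assoc (e _ _)]
    rcases hij with hij | hij
    · rw [← hi_eq_lo hij, simple_hi,
        simple_of_ne (i := i) (a := hi j) (by simp [hi]; omega) (by simp [hi]; omega),
        simple_of_ne (i := j) (a := lo i) (by simp [lo]; omega) (by simp [lo]; omega), simple_hi,
        hi_eq_lo hij, mul_assoc]
    · rw [hi_eq_lo hij, simple_lo,
        simple_of_ne (i := i) (a := lo j) (by simp [lo]; omega) (by simp [lo]; omega),
        simple_of_ne (i := j) (a := hi i) (by simp [hi]; omega) (by simp [hi]; omega),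
        ← hi_eq_lo hij, simple_lo, mul_assoc]
  eeg_left i j hij := by
    rw [mul_assoc (e _ _) (g j), h.g_e, ← mul_assoc]
    congr 1
    rcases hij with hij | hij
    · rw [hi_eq_lo hij, simple_lo,
        simple_of_ne (i := j) (a := lo i) (by simp [lo]; omega) (by simp [lo]; omega), h.e_trans]
    · rw [← hi_eq_lo hij, simple_hi,
        simple_of_ne (i := j) (a := hi i) (by simp [hi]; omega) (by simp [hi]; omega),
        h.e_symm (hi j), h.e_symm (lo j), h.e_trans, h.e_symm (hi i) (lo j)]
  eeg_right i j hij := by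
    rw [mul_assoc (e _ _) (g j), h.g_e, mul_assoc (e (simple j _) _) (g j), h.g_e, ← mul_assoc,
      ← mul_assoc]
    congr 1
    rcases hij with hij | hij
    · rw [hi_eq_lo hij, simple_lo, simple_hi,
        simple_of_ne (i := j) (a := lo i) (by simp [lo]; omega) (by simp [lo]; omega), h.e_trans,
        h.e_comm]
    · rw [← hi_eq_lo hij, simple_hi, simple_lo,
        simple_of_ne (i := j) (a := hi i) (by simp [hi]; omega) (by simp [hi]; omega),
        h.e_comm, h.e_symm (lo j) (hi i), h.e_symm (hi j) (lo j), h.e_trans, h.e_symm (hi j)]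
  ee_comm i j := h.e_comm _ _ _ _
  ge_far i j hij := by
    rw [h.g_e]
    rcases hij with hij | hij <;>
      rw [simple_of_ne (a := lo j) (by simp [lo]; omega) (by simp [lo]; omega),
        simple_of_ne (a := hi j) (by simp [hi]; omega) (by simp [hi]; omega)]
  e_sq i := by rw [pow_two, h.e_idem]
  g_quad := h.g_quad

end IsTieSystem

/-! ### The relations of the Yokonuma-Hecke algebra in an arbitrary algebra -/

/-- The tie `c ∑_{s < r} t_a ^ s t_b ^ {r - s}`, where `c` stands for `1 / r`. -/
def yTie (r : ℕ) (c : K) (t : Fin n → A) (a b : Fin n) : A :=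
  c • ∑ s ∈ Finset.range r, t a ^ s * t b ^ (r - s)

/-- Elements `g_i`, `t_j` of a `K`-algebra satisfy the relations of the Yokonuma-Hecke algebra,
where `c` stands for `1 / r`. -/
structure IsYokonuma (r : ℕ) (c : K) (q : Kˣ) (g : Fin (n - 1) → A) (t : Fin n → A) : Prop where
  t_pow : ∀ a, t a ^ r = 1
  t_comm : ∀ a b, t a * t b = t b * t a
  t_g : ∀ i a, t a * g i = g i * t (simple i a)
  g_far : ∀ i j, Far i j → g i * g j = g j * g i
  g_braid : ∀ i j : Fin (n - 1), i.val + 1 = j.val → g i * g j * g i = g j * g i * g j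
  g_quad : ∀ i, g i ^ 2 = 1 + ((q : K) - (q⁻¹ : Kˣ)) • (yTie r c t (lo i) (hi i) * g i)

namespace IsYokonuma

variable {r : ℕ} {c : K} {q : Kˣ} {g : Fin (n - 1) → A} {t : Fin n → A}

theorem commute_t (h : IsYokonuma r c q g t) (a b : Fin n) : Commute (t a) (t b) := h.t_comm a b

theorem g_yTie (h : IsYokonuma r c q g t) (i : Fin (n - 1)) (a b : Fin n) :
    g i * yTie r c t a b = yTie r c t (simple i a) (simple i b) * g i := by
  have ht : ∀ a, SemiconjBy (g i) (t a) (t (simple i a)) := fun a => by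
    have := h.t_g i (simple i a)
    rw [simple_simple] at this
    exact this.symm
  rw [yTie, yTie, mul_smul_comm, smul_mul_assoc, Finset.mul_sum, Finset.sum_mul]
  exact congrArg (c • ·) (Finset.sum_congr rfl fun s _ =>
    ((ht a).pow_right s).mul_right ((ht b).pow_right (r - s)))

theorem commute_yTie {x : A} (hx : ∀ a, Commute x (t a))
    (a b : Fin n) : Commute x (yTie r c t a b) :=
  (Commute.sum_right _ _ _ fun s _ =>
    ((hx a).pow_right s).mul_right ((hx b).pow_right (r - s))).smul_right c

theorem t_mul_yTie {A : Type*} [Ring A] [Algebra K A] {g : Fin (n - 1) → A} {t : Fin n → A}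
    (h : IsYokonuma r c q g t) (a b : Fin n) :
    t a * yTie r c t a b = t b * yTie r c t a b := by
  let F : ℕ → A := fun s => t a ^ s * t b ^ (r + 1 - s)
  have h1 : ∀ s ∈ Finset.range r, t a * (t a ^ s * t b ^ (r - s)) = F (s + 1) := fun s _ => by
    simp only [F, pow_succ', Nat.add_sub_add_right, mul_assoc]
  have h2 : ∀ s ∈ Finset.range r, t b * (t a ^ s * t b ^ (r - s)) = F s := fun s hs => by
    simp only [F]
    rw [← mul_assoc, ((h.commute_t b a).pow_right s).eq, mul_assoc, ← pow_succ',
      Nat.sub_add_comm (Finset.mem_range.1 hs).le]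
  have h3 : F r = F 0 := by simp [F, h.t_pow, pow_succ]
  rw [yTie, mul_smul_comm, mul_smul_comm, Finset.mul_sum, Finset.mul_sum,
    Finset.sum_congr rfl h1, Finset.sum_congr rfl h2]
  congr 1
  have h4 := Finset.sum_range_succ F r
  rw [Finset.sum_range_succ' F r, h3] at h4
  exact add_right_cancel h4

/-- A tie fixes the elements on which its two letters act in the same way. -/
theorem yTie_mul_of_eq (h : IsYokonuma r c q g t) (hc : (r : K) * c = 1) {a b : Fin n} {x : A}
    (hx : t a * x = t b * x) : yTie r c t a b * x = x := by
  have h1 : ∀ s, t a ^ s * x = t b ^ s * x := fun s => by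
    induction s with
    | zero => simp
    | succ s ih =>
      rw [pow_succ, pow_succ', mul_assoc, hx, ← mul_assoc,
        ((h.commute_t a b).pow_left s).eq, mul_assoc, ih, mul_assoc]
  have h2 : ∀ s ∈ Finset.range r, t a ^ s * t b ^ (r - s) * x = x := fun s hs => by
    rw [((h.commute_t a b).pow_pow s _).eq, mul_assoc, h1, ← mul_assoc, ← pow_add,
      Nat.sub_add_cancel (Finset.mem_range.1 hs).le, h.t_pow, one_mul]
  rw [yTie, smul_mul_assoc, Finset.sum_mul, Finset.sum_congr rfl h2, Finset.sum_const,
    Finset.card_range, ← Nat.cast_smul_eq_nsmul K, smul_smul, mul_comm, hc, one_smul]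

theorem isTieSystem {A : Type*} [Ring A] [Algebra K A] {g : Fin (n - 1) → A} {t : Fin n → A}
    (h : IsYokonuma r c q g t) (hc : (r : K) * c = 1) :
    IsTieSystem q g (yTie r c t) := by
  have hct : ∀ a b d, Commute (t d) (yTie r c t a b) := fun a b d =>
    commute_yTie (fun a => h.t_comm d a) a b
  have hcc : ∀ a b a' b', Commute (yTie r c t a b) (yTie r c t a' b') := fun a b a' b' =>
    commute_yTie (fun d => (hct a b d).symm) a' b'
  have hsymm : ∀ a b, yTie r c t a b = yTie r c t b a := fun a b => by
    rw [← h.yTie_mul_of_eq hc (h.t_mul_yTie b a).symm, (hcc a b b a).eq,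
      h.yTie_mul_of_eq hc (h.t_mul_yTie a b).symm]
  refine ⟨h.g_far, h.g_braid, h.g_quad, h.g_yTie, fun a => ?_, hsymm, hcc,
    fun a b => h.yTie_mul_of_eq hc (h.t_mul_yTie a b), fun a b d => ?_⟩
  · rw [← mul_one (yTie r c t a a), h.yTie_mul_of_eq hc rfl]
  · -- Both sides equal the product of all three ties between `a`, `b` and `d`.
    have h1 : yTie r c t a d * (yTie r c t a b * yTie r c t b d) =
        yTie r c t a b * yTie r c t b d := by
      refine h.yTie_mul_of_eq hc ?_
      rw [← mul_assoc, h.t_mul_yTie, mul_assoc, ← mul_assoc (t b), (hct a b b).eq, mul_assoc,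
        h.t_mul_yTie, ← mul_assoc, ← (hct a b d).eq, mul_assoc]
    have h2 : yTie r c t b d * (yTie r c t a b * yTie r c t a d) =
        yTie r c t a b * yTie r c t a d := by
      refine h.yTie_mul_of_eq hc ?_
      rw [← mul_assoc, ← h.t_mul_yTie a b, mul_assoc, ← mul_assoc (t a), (hct a b a).eq, mul_assoc,
        h.t_mul_yTie, ← mul_assoc, ← (hct a b d).eq, mul_assoc]
    rw [← h1, ← h2, ← mul_assoc, (hcc a d a b).eq, ← mul_assoc, (hcc b d a b).eq, mul_assoc,
      mul_assoc, (hcc a d b d).eq]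

end IsYokonuma

namespace YokonumaHeckeK

variable {r : ℕ} {ξ : Kˣ} (h : IsAdmissible r ξ) (q : Kˣ)

/-- The element `t_j` of `Y_{r,n}^K(q)`. -/
def t (j : Fin n) : YokonumaHeckeK n h q := BaseChange.of _ (YokonumaHecke.t r j)

theorem natCast_mul_scalarHom : (r : K) * scalarHom h (scalarInv r) = 1 := by
  rw [← map_natCast (scalarHom h), ← map_mul, natCast_mul_scalarInv h.pos, map_one]

theorem specializeR_q_sub :
    specializeR h q (LaurentPolynomial.T 1 - LaurentPolynomial.T (-1)) =
      (q : K) - (q⁻¹ : Kˣ) := by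
  rw [map_sub, specializeR_q, specializeR, LaurentPolynomial.eval₂_T, zpow_neg_one]

theorem specializeR_C (a : Scalars r) :
    specializeR h q (LaurentPolynomial.C a) = scalarHom h a := by
  rw [specializeR, LaurentPolynomial.eval₂_C]

theorem e_eq (i : Fin (n - 1)) :
    e h q i = yTie r (scalarHom h (scalarInv r)) (t h q) (lo i) (hi i) := by
  change BaseChange.mk (specializeR h q) (YRel r n) (ye r i) = _
  rw [ye, BaseChange.mk_smul, specializeR_C, yTie, map_sum]
  simp only [map_mul, map_pow]
  rfl

theorem isYokonuma : IsYokonuma r (scalarHom h (scalarInv r)) q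
    (g h q : Fin (n - 1) → YokonumaHeckeK n h q) (t h q) := by
  have hq : ∀ x, BaseChange.mk (specializeR h q) (YRel r n)
      ((LaurentPolynomial.T 1 - LaurentPolynomial.T (-1) : BaseR r) • x) =
      ((q : K) - (q⁻¹ : Kˣ)) • BaseChange.mk (specializeR h q) (YRel r n) x := fun x => by
    rw [BaseChange.mk_smul, specializeR_q_sub]
  have hg : ∀ i : Fin (n - 1),
    g h q i = BaseChange.mk (specializeR h q) (YRel r n) (yg r i) := fun _ => rfl
  have ht : ∀ i : Fin n,
    t h q i = BaseChange.mk (specializeR h q) (YRel r n) (yt r i) := fun _ => rfl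
  have he : ∀ i : Fin (n - 1),
    e h q i = BaseChange.mk (specializeR h q) (YRel r n) (ye r i) := fun _ => rfl
  constructor <;> intros <;>
    simp only [← e_eq, he, hg, ht, ← map_mul, ← map_pow, ← hq,
      ← map_one (BaseChange.mk (specializeR h q) _), ← map_add] <;>
    refine BaseChange.mk_rel ?_ <;> constructor <;> assumption

variable {q h}

/-- The universal property of `Y_{r,n}^K(q)`. -/
theorem exists_algHom {g' : Fin (n - 1) → A} {t' : Fin n → A}
    (H : IsYokonuma r (scalarHom h (scalarInv r)) q g' t') :
    ∃ φ : YokonumaHeckeK n h q →ₐ[K] A, (∀ i, φ (g h q i) = g' i) ∧ ∀ j, φ (t h q j) = t' j := by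
  let v : YGen n → A := fun x => match x with
    | YGen.g i => g' i
    | YGen.t j => t' j
  have hg : ∀ i : Fin (n - 1), BaseChange.eval (specializeR h q) v (yg r i) = g' i :=
    fun i => BaseChange.eval_ι v (YGen.g i)
  have ht : ∀ i : Fin n, BaseChange.eval (specializeR h q) v (yt r i) = t' i :=
    fun i => BaseChange.eval_ι v (YGen.t i)
  have he : ∀ i : Fin (n - 1), BaseChange.eval (specializeR h q) v (ye r i) =
      yTie r (scalarHom h (scalarInv r)) t' (lo i) (hi i) := fun i => by
    rw [ye, BaseChange.eval_smul, specializeR_C, yTie, map_sum]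
    simp only [map_mul, map_pow, ht]
  obtain ⟨φ, hφ⟩ := BaseChange.exists_algHom_mk_eq_eval (f := specializeR h q) (rel := YRel r n) v
    (by
      intro x y hxy
      cases hxy <;>
        simp only [map_mul, map_pow, map_add, map_one, BaseChange.eval_smul, specializeR_q_sub,
          hg, ht, he]
      · exact H.t_pow _
      · exact H.t_comm _ _
      · exact H.t_g _ _
      · exact H.g_far _ _ ‹_›
      · exact H.g_braid _ _ ‹_›
      · exact H.g_quad _)
  exact ⟨φ, fun i => (hφ (yg r i)).trans (hg i), fun j => (hφ (yt r j)).trans (ht j)⟩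

end YokonumaHeckeK

end TieSystem

/-! ### The operators on the tensor space -/

section Braid

variable {K : Type*} [CommRing K] {M : Type*} [AddCommGroup M] [Module K M]
  {ι κ : Type*} [LinearOrder ι] [DecidableEq κ]

/-- The braid relation for `𝐆` on three tensor factors; `F x y z` stands for `v_x ⊗ v_y ⊗ v_z`. -/
theorem braid_of_apply (q : Kˣ) (G₁ G₂ : Module.End K M) (F : ι × κ → ι × κ → ι × κ → M)
    (h₁ : ∀ x y z, G₁ (F x y z) = if x.2 ≠ y.2 then F y x z
      else if x.1 = y.1 then (q : K) • F x y z
      else if x.1 > y.1 then F y x z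
      else ((q : K) - (q⁻¹ : Kˣ)) • F x y z + F y x z)
    (h₂ : ∀ x y z, G₂ (F x y z) = if y.2 ≠ z.2 then F x z y
      else if y.1 = z.1 then (q : K) • F x y z
      else if y.1 > z.1 then F x z y
      else ((q : K) - (q⁻¹ : Kˣ)) • F x y z + F x z y) (x y z : ι × κ) :
    G₁ (G₂ (G₁ (F x y z))) = G₂ (G₁ (G₂ (F x y z))) := by
  have hq : (q : K) * (q⁻¹ : Kˣ) = 1 := by simp
  have n₁ : ∀ a b s t z, s ≠ t → G₁ (F (a, s) (b, t) z) = F (b, t) (a, s) z :=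
    fun a b s t z h => by simp [h₁, h]
  have e₁ : ∀ a s z, G₁ (F (a, s) (a, s) z) = (q : K) • F (a, s) (a, s) z :=
    fun a s z => by simp [h₁]
  have g₁ : ∀ a b s z, b < a → G₁ (F (a, s) (b, s) z) = F (b, s) (a, s) z :=
    fun a b s z h => by simp [h₁, h, h.ne']
  have l₁ : ∀ a b s z, a < b → G₁ (F (a, s) (b, s) z) =
      ((q : K) - (q⁻¹ : Kˣ)) • F (a, s) (b, s) z + F (b, s) (a, s) z :=
    fun a b s z h => by simp [h₁, h.ne, h.not_gt]
  have n₂ : ∀ a b s t z, s ≠ t → G₂ (F z (a, s) (b, t)) = F z (b, t) (a, s) :=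
    fun a b s t z h => by simp [h₂, h]
  have e₂ : ∀ a s z, G₂ (F z (a, s) (a, s)) = (q : K) • F z (a, s) (a, s) :=
    fun a s z => by simp [h₂]
  have g₂ : ∀ a b s z, b < a → G₂ (F z (a, s) (b, s)) = F z (b, s) (a, s) :=
    fun a b s z h => by simp [h₂, h, h.ne']
  have l₂ : ∀ a b s z, a < b → G₂ (F z (a, s) (b, s)) =
      ((q : K) - (q⁻¹ : Kˣ)) • F z (a, s) (b, s) + F z (b, s) (a, s) :=
    fun a b s z h => by simp [h₂, h.ne, h.not_gt]
  clear h₁ h₂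
  obtain ⟨a, s⟩ := x
  obtain ⟨b, t⟩ := y
  obtain ⟨c, u⟩ := z
  generalize ((q⁻¹ : Kˣ) : K) = p at *
  generalize (q : K) = q at *
  by_cases hst : s = t
  · subst hst
    by_cases hsu : s = u
    · subst hsu
      rcases lt_trichotomy a b with h | h | h <;> rcases lt_trichotomy b c with h' | h' | h' <;>
      rcases lt_trichotomy a c with h'' | h'' | h'' <;> try order
      all_goals
        simp only [e₁, g₁, l₁, e₂, g₂, l₂, h, h', h'', map_add, map_smul]
        try match_scalars <;>
          first | ring1 | linear_combination (p - q) * hq | linear_combination (q - p) * hq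
    · have hus := Ne.symm hsu
      rcases lt_trichotomy a b with h | h | h <;>
        simp only [n₁ _ _ _ _ _ hsu, n₂ _ _ _ _ _ hsu,
          e₁, g₁, l₁, e₂, g₂, l₂, h, map_add, map_smul]
  · have hts := Ne.symm hst
    by_cases htu : t = u
    · subst htu
      rcases lt_trichotomy b c with h | h | h <;>
        simp only [n₁ _ _ _ _ _ hst, n₂ _ _ _ _ _ hst,
          e₁, g₁, l₁, e₂, g₂, l₂, h, map_add, map_smul]
    · have hut := Ne.symm htu
      by_cases hsu : s = u
      · subst hsu
        rcases lt_trichotomy a c with h | h | h <;>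
          simp only [n₁ _ _ _ _ _ hst, n₁ _ _ _ _ _ hts, n₂ _ _ _ _ _ hst, n₂ _ _ _ _ _ hts,
            e₁, g₁, l₁, e₂, g₂, l₂, h, map_add, map_smul]
      · rw [n₁ _ _ _ _ _ hst, n₂ _ _ _ _ _ hsu, n₁ _ _ _ _ _ htu, n₂ _ _ _ _ _ htu,
          n₁ _ _ _ _ _ hsu, n₂ _ _ _ _ _ hst]

end Braid

section Operators

variable {K : Type*} [CommRing K] {r n : ℕ}

theorem opG_apply (q : Kˣ) (i : Fin (n - 1)) (f : Fin n → Fin n × Fin r) :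
    opG r q i (tensorBasis K r n f) =
      if (f (lo i)).2 ≠ (f (hi i)).2 then tensorBasis K r n (f ∘ simple i)
      else if (f (lo i)).1 = (f (hi i)).1 then (q : K) • tensorBasis K r n f
      else if (f (lo i)).1 > (f (hi i)).1 then tensorBasis K r n (f ∘ simple i)
      else ((q : K) - (q⁻¹ : Kˣ)) • tensorBasis K r n f + tensorBasis K r n (f ∘ simple i) :=
  Module.Basis.constr_basis _ _ _ _

theorem opE_apply (i : Fin (n - 1)) (f : Fin n → Fin n × Fin r) :
    opE K r i (tensorBasis K r n f) =
      if (f (lo i)).2 = (f (hi i)).2 then tensorBasis K r n f else 0 :=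
  Module.Basis.constr_basis _ _ _ _

/-- The coefficient of `v_x ⊗ v_y` in `(v_x ⊗ v_y)𝐆 - v_y ⊗ v_x`. -/
def gCoeff (q : Kˣ) (x y : Fin n × Fin r) : K :=
  if x.2 ≠ y.2 then 0 else if x.1 = y.1 then q - 1 else if x.1 > y.1 then 0
    else (q : K) - (q⁻¹ : Kˣ)

theorem comp_simple_of_eq {X : Type*} {i : Fin (n - 1)} {f : Fin n → X}
    (h : f (lo i) = f (hi i)) : f ∘ simple i = f := by
  funext k
  rw [Function.comp_apply, simple, Equiv.swap_apply_def]
  split_ifs with h1 h2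
  · rw [h1, h]
  · rw [h2, h]
  · rfl

theorem comp_simple_comp_simple {X : Type*} (i : Fin (n - 1)) (f : Fin n → X) :
    (f ∘ simple i) ∘ simple i = f :=
  funext fun k => congrArg f (simple_simple i k)

/-- A formula for `𝐆_i` without case distinction on the permuted term: equal factors contribute
`q - 1` since then permuting them does nothing. -/
theorem opG_apply_eq_add (q : Kˣ) (i : Fin (n - 1)) (f : Fin n → Fin n × Fin r) :
    opG r q i (tensorBasis K r n f) =
      gCoeff q (f (lo i)) (f (hi i)) • tensorBasis K r n f + tensorBasis K r n (f ∘ simple i) := by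
  rw [opG_apply, gCoeff]
  split_ifs with h1 h2
  · rw [zero_smul, zero_add]
  · rw [comp_simple_of_eq (Prod.ext h2 (not_not.1 h1))]
    module
  · rw [zero_smul, zero_add]
  · rfl

theorem gCoeff_of_ne (q : Kˣ) {x y : Fin n × Fin r} (h : x.2 ≠ y.2) : gCoeff (K := K) q x y = 0 :=
  if_pos h

theorem opG_comm (q : Kˣ) {i j : Fin (n - 1)} (h : Far i j) :
    opG (K := K) r q i * opG r q j = opG r q j * opG r q i := by
  have h1 : simple i * simple j = simple j * simple i := by
    refine (Equiv.Perm.Disjoint.commute fun a => ?_).eq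
    by_cases ha : a.val = i.val ∨ a.val = i.val + 1
    · rcases h with h | h <;> exact Or.inr (simple_of_ne (by omega) (by omega))
    · exact Or.inl (simple_of_ne (by omega) (by omega))
  have h2 : ∀ {i j : Fin (n - 1)}, Far i j → simple i (lo j) = lo j ∧ simple i (hi j) = hi j := by
    intro i j h
    rcases h with h | h <;> constructor <;> refine simple_of_ne ?_ ?_ <;> simp [lo, hi] <;> omega
  refine (tensorBasis K r n).ext fun f => ?_
  have h3 : (f ∘ simple j) ∘ simple i = (f ∘ simple i) ∘ simple j := by
    rw [Function.comp_assoc, Function.comp_assoc, ← Equiv.Perm.coe_mul, ← Equiv.Perm.coe_mul, h1]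
  simp only [Module.End.mul_apply, opG_apply_eq_add, map_add, map_smul, Function.comp_apply, h2 h,
    h2 h.symm, h3]
  module

theorem opG_braid (q : Kˣ) {i j : Fin (n - 1)} (h : i.val + 1 = j.val) :
    opG (K := K) r q i * opG r q j * opG r q i = opG r q j * opG r q i * opG r q j := by
  refine (tensorBasis K r n).ext fun f => ?_
  have hij : hi i = lo j := hi_eq_lo h
  have n1 : lo i ≠ lo j := hij ▸ lo_ne_hi i
  have n2 : lo j ≠ hi j := lo_ne_hi j
  have n3 : lo i ≠ hi j := by simp [lo, hi, Fin.ext_iff]; omega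
  -- `F x y z` is obtained from `f` by writing `x`, `y`, `z` in three consecutive positions.
  let F : Fin n × Fin r → Fin n × Fin r → Fin n × Fin r → TensorSpace K r n := fun x y z =>
    tensorBasis K r n
      (Function.update (Function.update (Function.update f (lo i) x) (lo j) y) (hi j) z)
  have hF : tensorBasis K r n f = F (f (lo i)) (f (lo j)) (f (hi j)) := by simp [F]
  have key := braid_of_apply q (opG r q i) (opG r q j) F
    (fun x y z => by
      simp only [F, opG_apply, hij, Function.update_self, Function.update_of_ne n1,
        Function.update_of_ne n2, Function.update_of_ne n3]
      have : ∀ k,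
        (Function.update (Function.update (Function.update f (lo i) x) (lo j) y) (hi j) z)
          (simple i k) =
        (Function.update (Function.update (Function.update f (lo i) y) (lo j) x) (hi j) z) k := by
        intro k
        simp only [simple, hij, Equiv.swap_apply_def, Function.update_apply]
        grind
      simp only [funext this, Function.comp_def])
    (fun x y z => by
      simp only [F, opG_apply, Function.update_self, Function.update_of_ne n2]
      have : ∀ k,
        (Function.update (Function.update (Function.update f (lo i) x) (lo j) y) (hi j) z)
          (simple j k) =
        (Function.update (Function.update (Function.update f (lo i) x) (lo j) z) (hi j) y) k := by
        intro k
        simp only [simple, Equiv.swap_apply_def, Function.update_apply]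
        grind
      simp only [funext this, Function.comp_def])
    (f (lo i)) (f (lo j)) (f (hi j))
  rw [← hF] at key
  exact key

/-- The diagonal operators on the tensor space whose eigenvalue on a basis vector depends on the
upper indices of the vector only. -/
def opDiag : ((Fin n → Fin r) → K) →ₐ[K] Module.End K (TensorSpace K r n) :=
  let D (d : (Fin n → Fin r) → K) : Module.End K (TensorSpace K r n) :=
    (tensorBasis K r n).constr K fun f => d (fun k => (f k).2) • tensorBasis K r n f
  have h (d : (Fin n → Fin r) → K) (f : Fin n → Fin n × Fin r) :
      D d (tensorBasis K r n f) = d (fun k => (f k).2) • tensorBasis K r n f :=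
    Module.Basis.constr_basis _ _ _ _
  AlgHom.ofLinearMap
    { toFun := D
      map_add' := fun d d' => (tensorBasis K r n).ext fun f => by
        rw [LinearMap.add_apply, h, h, h, Pi.add_apply, add_smul]
      map_smul' := fun c d => (tensorBasis K r n).ext fun f => by
        rw [LinearMap.smul_apply, h, h, Pi.smul_apply, smul_assoc, RingHom.id_apply] }
    ((tensorBasis K r n).ext fun f => (h 1 f).trans (one_smul K _))
    fun d d' => (tensorBasis K r n).ext fun f => by
      change D (d * d') (tensorBasis K r n f) = D d (D d' (tensorBasis K r n f))
      rw [h, h, map_smul, h, Pi.mul_apply, mul_comm, mul_smul]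

theorem opDiag_apply (d : (Fin n → Fin r) → K) (f : Fin n → Fin n × Fin r) :
    opDiag d (tensorBasis K r n f) = d (fun k => (f k).2) • tensorBasis K r n f :=
  Module.Basis.constr_basis (tensorBasis K r n) K _ f

/-- `𝐆_i` permutes the diagonal operators: it scales a basis vector without permuting it only if
the permutation would not change the upper indices. -/
theorem opG_mul_opDiag (q : Kˣ) (i : Fin (n - 1)) (d : (Fin n → Fin r) → K) :
    opG r q i * opDiag d = opDiag (fun c => d (c ∘ simple i)) * opG r q i := by
  refine (tensorBasis K r n).ext fun f => ?_
  have h1 : (fun k => ((f ∘ simple i) k).2) ∘ simple i = fun k => (f k).2 :=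
    funext fun k => congrArg (fun k => (f k).2) (simple_simple i k)
  simp only [Module.End.mul_apply, opDiag_apply, opG_apply_eq_add, map_add, map_smul, h1]
  by_cases h : (f (lo i)).2 = (f (hi i)).2
  · rw [comp_simple_of_eq (f := fun k => (f k).2) h]
    module
  · rw [gCoeff_of_ne q h]
    module

/-- The tie between two tensor factors: it keeps the basis vectors whose upper indices in these
factors agree, and kills the others. -/
def opTie (K : Type*) [CommRing K] (r : ℕ) {n : ℕ} (a b : Fin n) :
    Module.End K (TensorSpace K r n) :=
  opDiag fun c => if c a = c b then 1 else 0

theorem opTie_apply (a b : Fin n) (f : Fin n → Fin n × Fin r) :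
    opTie K r a b (tensorBasis K r n f) =
      if (f a).2 = (f b).2 then tensorBasis K r n f else 0 := by
  rw [opTie, opDiag_apply, ite_smul, one_smul, zero_smul]

theorem opTie_lo_hi (i : Fin (n - 1)) : opTie K r (lo i) (hi i) = opE K r i :=
  (tensorBasis K r n).ext fun f => by rw [opTie_apply, opE_apply]

theorem opG_mul_opTie (q : Kˣ) (i : Fin (n - 1)) (a b : Fin n) :
    opG r q i * opTie K r a b = opTie K r (simple i a) (simple i b) * opG r q i :=
  opG_mul_opDiag q i _

theorem opG_sq (q : Kˣ) (i : Fin (n - 1)) : opG r q i ^ 2 =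
    1 + ((q : K) - (q⁻¹ : Kˣ)) • (opG r q i * opTie K r (lo i) (hi i)) := by
  refine (tensorBasis K r n).ext fun f => ?_
  have hq : (q : K) * (q⁻¹ : Kˣ) = 1 := by simp
  rw [pow_two, Module.End.mul_apply, LinearMap.add_apply, LinearMap.smul_apply,
    Module.End.mul_apply, Module.End.one_apply, opTie_apply]
  by_cases h : (f (lo i)).2 = (f (hi i)).2
  · rw [if_pos h]
    rcases lt_trichotomy (f (lo i)).1 (f (hi i)).1 with h' | h' | h'
    · simp [opG_apply, h, h'.ne, h'.ne', h'.not_gt, h', simple_lo, simple_hi,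
        comp_simple_comp_simple]
      module
    · simp only [opG_apply, h, h', map_smul, ne_eq, not_true_eq_false, if_true, if_false]
      match_scalars
      linear_combination hq
    · simp [opG_apply, h, h'.ne, h'.ne', h'.not_gt, h', simple_lo, simple_hi,
        comp_simple_comp_simple]
      module
  · simp [opG_apply, h, Ne.symm h, simple_lo, simple_hi, comp_simple_comp_simple]

open MulOpposite

theorem isTieSystem_op (q : Kˣ) :
    IsTieSystem q (fun i : Fin (n - 1) => op (opG (K := K) r q i))
      (fun a b => op (opTie K r a b)) where
  g_far i j h := congrArg op (opG_comm q h.symm)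
  g_braid i j h := congrArg op ((mul_assoc _ _ _).symm.trans ((opG_braid q h).trans
    (mul_assoc _ _ _)))
  g_quad i := congrArg op (opG_sq q i)
  g_e i a b := congrArg op (by
    rw [unop_op, unop_op, unop_op, opG_mul_opTie, simple_simple, simple_simple])
  e_self a := congrArg op (by simp [opTie]; exact map_one opDiag)
  e_symm a b := congrArg op (by simp only [opTie, eq_comm])
  e_comm a b c d := congrArg op (by
    simp only [unop_op]
    rw [opTie, opTie, ← map_mul, ← map_mul, mul_comm])
  e_idem a b := congrArg op (by
    rw [unop_op, opTie, ← map_mul]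
    congr 1
    funext c
    simp only [Pi.mul_apply]
    split_ifs <;> simp)
  e_trans a b d := congrArg op (by
    simp only [unop_op]
    rw [opTie, opTie, opTie, ← map_mul, ← map_mul]
    congr 1
    funext c
    simp only [Pi.mul_apply]
    grind)

/-- The operator on the tensor space multiplying by `ξ` to the power of the upper index in the
given factor. -/
def opT (ξ : K) (r : ℕ) {n : ℕ} (a : Fin n) : Module.End K (TensorSpace K r n) :=
  opDiag fun c => ξ ^ (c a).val

theorem isUnit_one_sub_pow {ξ : Kˣ} (h : IsAdmissible r ξ) {d : ℕ} (h0 : 0 < d) (hd : d < r) :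
    IsUnit (1 - (ξ : K) ^ d) := by
  refine isUnit_of_dvd_unit ?_ h.isUnit_vandermonde
  rw [← pow_zero (ξ : K)]
  exact (Finset.dvd_prod_of_mem (fun i => (ξ : K) ^ i - (ξ : K) ^ d)
      (Finset.mem_range.2 h0)).trans
      (Finset.dvd_prod_of_mem (fun j => ∏ i ∈ Finset.range j, ((ξ : K) ^ i - (ξ : K) ^ j))
        (Finset.mem_range.2 hd))

/-- Orthogonality of the powers of `ξ`. -/
theorem sum_pow_mul_pow {ξ : Kˣ} (h : IsAdmissible r ξ) {x y : ℕ} (hx : x < r) (hy : y < r) :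
    ∑ s ∈ Finset.range r, ((ξ : K) ^ x) ^ s * ((ξ : K) ^ y) ^ (r - s) =
      if x = y then (r : K) else 0 := by
  have hξ : (ξ : K) ^ r = 1 := by
    rw [← Units.val_pow_eq_pow_val, h.pow_eq_one, Units.val_one]
  have hp : ∀ x : ℕ, ((ξ : K) ^ x) ^ r = 1 := fun x => by rw [← pow_mul, mul_comm, pow_mul, hξ,
    one_pow]
  split_ifs with hxy
  · subst hxy
    rw [Finset.sum_congr rfl (g := fun _ => (1 : K)) fun s hs => by
      rw [← pow_add, Nat.add_sub_cancel' (Finset.mem_range.1 hs).le, hp]]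
    simp
  · have h1 : ((ξ : K) ^ x - (ξ : K) ^ y) *
        ∑ s ∈ Finset.range r, ((ξ : K) ^ x) ^ s * ((ξ : K) ^ y) ^ (r - s) = 0 := by
      have h2 := (Commute.all ((ξ : K) ^ x) ((ξ : K) ^ y)).mul_geom_sum₂ r
      rw [hp, hp, sub_self] at h2
      rw [← mul_zero ((ξ : K) ^ y), ← h2, mul_left_comm, Finset.mul_sum (a := (ξ : K) ^ y)]
      congr 1
      refine Finset.sum_congr rfl fun s hs => ?_
      have : r - s = r - 1 - s + 1 := by have := Finset.mem_range.1 hs; omega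
      rw [this, pow_succ]
      ring
    have hu : IsUnit ((ξ : K) ^ x - (ξ : K) ^ y) := by
      rcases Nat.lt_or_gt_of_ne hxy with hlt | hlt
      · have := (ξ.isUnit.pow x).mul (isUnit_one_sub_pow h (Nat.sub_pos_of_lt hlt) (by omega))
        rwa [mul_sub, mul_one, ← pow_add, Nat.add_sub_cancel' hlt.le] at this
      · have := (ξ.isUnit.pow y).mul (isUnit_one_sub_pow h (Nat.sub_pos_of_lt hlt) (by omega))
        rw [mul_sub, mul_one, ← pow_add, Nat.add_sub_cancel' hlt.le] at this
        simpa using this.neg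
    exact (hu.mul_right_eq_zero).1 h1

theorem yTie_op_opT {ξ : Kˣ} (h : IsAdmissible r ξ) (a b : Fin n) :
    yTie r (scalarHom h (scalarInv r)) (fun a => op (opT (ξ : K) r a)) a b =
      op (opTie K r a b) := by
  rw [yTie]
  simp only [← op_pow, ← op_mul, opT, ← map_pow, ← map_mul]
  rw [← Finset.op_sum, ← op_smul, ← map_sum, ← map_smul, opTie]
  congr 2
  funext c
  have h1 := YokonumaHeckeK.natCast_mul_scalarHom h
  have h2 := sum_pow_mul_pow h (c a).2 (c b).2
  rw [Pi.smul_apply, Finset.sum_apply]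
  simp only [Pi.mul_apply, Pi.pow_apply]
  rw [Finset.sum_congr rfl fun s _ => mul_comm _ _, h2]
  simp only [Fin.val_inj, smul_eq_mul, mul_ite, mul_zero, mul_comm _ (r : K), h1]

theorem isYokonuma_op {ξ : Kˣ} (h : IsAdmissible r ξ) (q : Kˣ) :
    IsYokonuma r (scalarHom h (scalarInv r)) q
      (fun i : Fin (n - 1) => op (opG (K := K) r q i)) (fun a => op (opT (ξ : K) r a)) where
  t_pow a := congrArg op (by
    rw [unop_op, opT, ← map_pow, ← map_one opDiag]
    congr 1
    funext c
    rw [Pi.pow_apply, Pi.one_apply, ← pow_mul, mul_comm, pow_mul, ← Units.val_pow_eq_pow_val,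
      h.pow_eq_one, Units.val_one, one_pow])
  t_comm a b := congrArg op (by
    simp only [unop_op]
    rw [opT, opT, ← map_mul, ← map_mul, mul_comm])
  t_g i a := congrArg op (opG_mul_opDiag q i _)
  g_far := (isTieSystem_op q).g_far
  g_braid := (isTieSystem_op q).g_braid
  g_quad i := by
    rw [yTie_op_opT]
    exact (isTieSystem_op q).g_quad i

end Operators

/-! ### Ties between arbitrary letters -/

section BraidAction

variable {G X : Type*} [Group G] [MulAction G X]

/-- Group elements `c_k`, `k < N`, satisfying the braid relations and acting on points `x_k` as
the Artin generators act by conjugation on the ties between neighbouring letters. -/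
structure IsBraidAction (N : ℕ) (c : ℕ → G) (x : ℕ → X) : Prop where
  braid : ∀ k, k + 1 < N → c k * c (k + 1) * c k = c (k + 1) * c k * c (k + 1)
  comm : ∀ k l, k + 1 < l → l < N → c k * c l = c l * c k
  fix : ∀ k, k < N → c k • x k = x k
  fix_of_lt : ∀ k l, k + 1 < l → l < N → c k • x l = x l
  fix_of_gt : ∀ k l, k + 1 < l → l < N → c l • x k = x k
  near : ∀ k, k + 1 < N → c k • x (k + 1) = c (k + 1) • x k
  sq_succ : ∀ k, k + 1 < N → c k • c k • x (k + 1) = x (k + 1)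
  sq : ∀ k, k + 1 < N → c (k + 1) • c (k + 1) • x k = x k

/-- The tie between the letters `i` and `i + d + 1`. -/
def tiePoint (c : ℕ → G) (x : ℕ → X) (i : ℕ) : ℕ → X
  | 0 => x i
  | d + 1 => c (i + d + 1) • tiePoint c x i d

theorem tiePoint_succ (c : ℕ → G) (x : ℕ → X) (i d : ℕ) :
    tiePoint c x i (d + 1) = c (i + d + 1) • tiePoint c x i d :=
  rfl

namespace IsBraidAction

variable {N : ℕ} {c : ℕ → G} {x : ℕ → X} (h : IsBraidAction N c x)
include h

theorem smul_smul_comm {k l : ℕ} (hkl : k + 1 < l) (hl : l < N) (y : X) :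
    c k • c l • y = c l • c k • y := by
  rw [smul_smul, h.comm k l hkl hl, mul_smul]

theorem smul_of_gt {i d l : ℕ} (hl : i + d + 1 < l) (hN : l < N) :
    c l • tiePoint c x i d = tiePoint c x i d := by
  induction d with
  | zero => exact h.fix_of_gt i l hl hN
  | succ d ih =>
    rw [tiePoint, ← h.smul_smul_comm (by omega) hN, ih (by omega)]

theorem smul_of_lt {i d k : ℕ} (hk : k + 1 < i) (hN : i + d < N) :
    c k • tiePoint c x i d = tiePoint c x i d := by
  induction d with
  | zero => exact h.fix_of_lt k i hk hN
  | succ d ih =>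
    rw [tiePoint, h.smul_smul_comm (by omega) (by omega), ih (by omega)]

/-- Ties can be lengthened on the left as well as on the right. -/
theorem smul_tiePoint_succ {i d : ℕ} (hN : i + d + 1 < N) :
    c i • tiePoint c x (i + 1) d = tiePoint c x i (d + 1) := by
  induction d with
  | zero => exact h.near i hN
  | succ d ih =>
    rw [tiePoint, h.smul_smul_comm (by omega) (by omega), ih (by omega),
      tiePoint_succ c x i (d + 1)]
    congr 2
    omega

/-- Squares of generators fix the ties whose upper letter they move upwards; the left-handed
recursion for ties reduces this to ties between neighbours. -/
theorem sq_upper {i d : ℕ} (hN : i + d + 1 < N) :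
    c (i + d + 1) • c (i + d + 1) • tiePoint c x i d = tiePoint c x i d := by
  induction d generalizing i with
  | zero => exact h.sq i hN
  | succ d ih =>
    have := ih (i := i + 1) (by omega)
    rw [show i + 1 + d + 1 = i + (d + 1) + 1 by omega] at this
    rw [← h.smul_tiePoint_succ (by omega), ← h.smul_smul_comm (k := i) (by omega) hN,
      ← h.smul_smul_comm (k := i) (by omega) hN, this]

theorem sq_lower {k d : ℕ} (hN : k + 1 + d < N) :
    c k • c k • tiePoint c x (k + 1) d = tiePoint c x (k + 1) d := by
  induction d with
  | zero => exact h.sq_succ k hN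
  | succ d ih =>
    rw [tiePoint, h.smul_smul_comm (l := k + 1 + d + 1) (by omega) (by omega),
      h.smul_smul_comm (l := k + 1 + d + 1) (by omega) (by omega), ih (by omega)]

/-- Generators moving only letters strictly between the two letters of a tie fix the tie. -/
theorem smul_inner {i d k : ℕ} (h1 : i < k) (h2 : k < i + d) (hN : i + d < N) :
    c k • tiePoint c x i d = tiePoint c x i d := by
  induction d with
  | zero => omega
  | succ d ih =>
    rcases Nat.lt_or_ge k (i + d) with hk | hk
    · rw [tiePoint, h.smul_smul_comm (by omega) (by omega), ih hk (by omega)]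
    · obtain ⟨d, rfl⟩ : ∃ e, d = e + 1 := ⟨d - 1, by omega⟩
      obtain rfl : k = i + d + 1 := by omega
      rw [tiePoint, tiePoint, smul_smul, smul_smul, ← add_assoc, h.braid _ (by omega), mul_smul,
        mul_smul, h.smul_of_gt (by omega) (by omega)]

end IsBraidAction

/-- The tie between two distinct letters, in either order. -/
def tieBetween (c : ℕ → G) (x : ℕ → X) (a b : ℕ) : X :=
  if a < b then tiePoint c x a (b - a - 1) else tiePoint c x b (a - b - 1)

theorem tieBetween_comm (c : ℕ → G) (x : ℕ → X) {a b : ℕ} (hab : a ≠ b) :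
    tieBetween c x a b = tieBetween c x b a := by
  unfold tieBetween
  split_ifs <;> first | rfl | omega

theorem tieBetween_eq (c : ℕ → G) (x : ℕ → X) {a b : ℕ} (d : ℕ) (h : b = a + d + 1) :
    tieBetween c x a b = tiePoint c x a d := by
  rw [tieBetween, if_pos (by omega), show b - a - 1 = d by omega]

/-- The adjacent transposition `(k, k + 1)` of the natural numbers. -/
def adjSwap (k a : ℕ) : ℕ := if a = k then k + 1 else if a = k + 1 then k else a

/-- The generators permute the ties through the adjacent transpositions, whether they lengthen,
shorten or fix them. -/
theorem IsBraidAction.smul_tieBetween {N : ℕ} {c : ℕ → G} {x : ℕ → X} (h : IsBraidAction N c x)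
    {k a b : ℕ} (hk : k < N) (ha : a ≤ N) (hb : b ≤ N) (hab : a ≠ b) :
    c k • tieBetween c x a b = tieBetween c x (adjSwap k a) (adjSwap k b) := by
  wlog hlt : a < b generalizing a b
  · have hs : adjSwap k a ≠ adjSwap k b := by
      unfold adjSwap
      split_ifs <;> omega
    rw [tieBetween_comm c x hab, tieBetween_comm c x hs]
    exact this hb ha hab.symm (by omega)
  obtain ⟨d, rfl⟩ : ∃ d, b = a + d + 1 := ⟨b - a - 1, by omega⟩
  rw [tieBetween_eq c x d rfl]
  rcases Nat.lt_or_ge (k + 1) a with h1 | h1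
  · rw [h.smul_of_lt h1 (by omega), tieBetween_eq c x d] <;> unfold adjSwap <;> split_ifs <;>
      first | rfl | omega
  rcases Nat.eq_or_lt_of_le h1 with rfl | h1
  · rw [h.smul_tiePoint_succ (by omega), tieBetween_eq c x (d + 1)] <;> unfold adjSwap <;>
      split_ifs <;> first | rfl | omega
  rcases Nat.eq_or_lt_of_le (Nat.le_of_lt_succ h1) with rfl | h1
  · cases d with
    | zero =>
      have e1 : adjSwap a a = a + 1 := if_pos rfl
      have e2 : adjSwap a (a + 0 + 1) = a := by simp [adjSwap]
      rw [e1, e2, tieBetween_comm c x (by omega), tieBetween_eq c x 0 rfl]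
      exact h.fix a hk
    | succ d =>
      rw [← h.smul_tiePoint_succ (by omega), h.sq_lower (by omega), tieBetween_eq c x d] <;>
        unfold adjSwap <;> split_ifs <;> first | rfl | omega
  rcases Nat.lt_or_ge k (a + d) with h2 | h2
  · rw [h.smul_inner h1 h2 (by omega), tieBetween_eq c x d] <;> unfold adjSwap <;> split_ifs <;>
      first | rfl | omega
  rcases Nat.eq_or_lt_of_le h2 with rfl | h2
  · obtain ⟨d, rfl⟩ : ∃ e, d = e + 1 := ⟨d - 1, by omega⟩
    rw [tiePoint, ← add_assoc, h.sq_upper (by omega), tieBetween_eq c x d] <;> unfold adjSwap <;>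
      split_ifs <;> first | rfl | omega
  rcases Nat.eq_or_lt_of_le h2 with rfl | h2
  · rw [tieBetween_eq c x (d + 1)]
    · unfold adjSwap
      rw [if_neg (by omega), if_neg (by omega)]
      rfl
    · unfold adjSwap
      split_ifs <;> omega
  · rw [h.smul_of_gt h2 hk, tieBetween_eq c x d] <;> unfold adjSwap <;> split_ifs <;>
      first | rfl | omega

end BraidAction

section TiesOfBraidTie

variable {K : Type*} [CommRing K] {n : ℕ}

/-- The simple transpositions generate the symmetric group. -/
theorem perm_induction_simple {P : Equiv.Perm (Fin n) → Prop} (h1 : P 1)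
    (hs : ∀ i, P (simple i)) (hm : ∀ σ τ, P σ → P τ → P (σ * τ)) (σ : Equiv.Perm (Fin n)) :
    P σ := by
  cases n with
  | zero => rwa [Subsingleton.elim σ 1]
  | succ m =>
    have h2 : σ ∈ Submonoid.closure
        (Set.range fun i : Fin m => Equiv.swap i.castSucc i.succ) := by
      rw [Equiv.Perm.mclosure_swap_castSucc_succ]
      trivial
    induction h2 using Submonoid.closure_induction with
    | mem x hx =>
      obtain ⟨i, rfl⟩ := hx
      exact hs i
    | one => exact h1
    | mul x y _ _ hx hy => exact hm x y hx hy

variable {A : Type*} [Ring A] [Algebra K A]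

namespace IsBraidTie

variable {q : Kˣ} {g e : Fin (n - 1) → A} (h : IsBraidTie q g e)
include h

theorem g_mul_self_sub (i : Fin (n - 1)) :
    g i * (g i - ((q : K) - (q⁻¹ : Kˣ)) • e i) = 1 := by
  rw [mul_sub, ← pow_two, h.g_quad, mul_smul_comm, h.ge_same, add_sub_cancel_right]

theorem self_sub_mul_g (i : Fin (n - 1)) :
    (g i - ((q : K) - (q⁻¹ : Kˣ)) • e i) * g i = 1 := by
  rw [sub_mul, ← pow_two, h.g_quad, smul_mul_assoc, add_sub_cancel_right]

theorem e_mul_e_mul_g {i j : Fin (n - 1)} (hij : Near i j) :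
    e i * e j * g j = g j * (e i * e j) := by
  rw [h.eeg_left i j hij, h.eeg_right i j hij, mul_assoc]

theorem g_sq_mul_e {i j : Fin (n - 1)} (hij : Near i j) :
    g j * g j * e i = e i * (g j * g j) := by
  rw [← pow_two, h.g_quad, add_mul, mul_add, one_mul, mul_one, smul_mul_assoc, mul_smul_comm,
    ← mul_assoc (e i), h.e_mul_e_mul_g hij, ← h.ge_same, h.ee_comm i j, mul_assoc]

/-- The element `g_i` as a unit acting on the algebra by conjugation; indices out of range give
the identity. -/
def conj (k : ℕ) : ConjAct Aˣ :=
  if hk : k < n - 1 then ConjAct.toConjAct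
    ⟨g ⟨k, hk⟩, g ⟨k, hk⟩ - ((q : K) - (q⁻¹ : Kˣ)) • e ⟨k, hk⟩, h.g_mul_self_sub _,
      h.self_sub_mul_g _⟩
  else 1

theorem coe_conj (i : Fin (n - 1)) : ((ConjAct.ofConjAct (h.conj i) : Aˣ) : A) = g i := by
  rw [conj, dif_pos i.2]
  rfl

theorem conj_smul_eq_iff (i : Fin (n - 1)) (x y : A) :
    h.conj i • x = y ↔ g i * x = y * g i := by
  rw [ConjAct.units_smul_def, Units.mul_inv_eq_iff_eq_mul, h.coe_conj]

theorem conj_smul_smul_eq_iff (i j : Fin (n - 1)) (x y : A) :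
    h.conj i • h.conj j • x = y ↔ g i * g j * x = y * (g i * g j) := by
  rw [smul_smul, ConjAct.units_smul_def, Units.mul_inv_eq_iff_eq_mul, ConjAct.ofConjAct_mul,
    Units.val_mul, h.coe_conj, h.coe_conj]

theorem isBraidAction : IsBraidAction (n - 1) h.conj
    (fun k => if hk : k < n - 1 then e ⟨k, hk⟩ else 0) := by
  have ext : ∀ {x y : ConjAct Aˣ},
      ((ConjAct.ofConjAct x : Aˣ) : A) = (ConjAct.ofConjAct y : Aˣ) → x = y :=
    fun hxy => ConjAct.ofConjAct.injective (Units.ext hxy)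
  have sq : ∀ i j : Fin (n - 1), Near i j → h.conj i • h.conj i • e j = e j := fun i j hij => by
    rw [h.conj_smul_smul_eq_iff, h.g_sq_mul_e hij.symm]
  have near : ∀ i j : Fin (n - 1), Near i j → h.conj i • e j = h.conj j • e i := by
    intro i j hij
    have h1 : h.conj i • h.conj j • e i = e j := by
      rw [h.conj_smul_smul_eq_iff, ← mul_assoc, h.egg _ _ hij.symm]
    exact smul_left_cancel (h.conj i) ((sq i j hij).trans h1.symm)
  constructor
  · intro k hk
    refine ext ?_
    simp only [ConjAct.ofConjAct_mul, Units.val_mul]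
    rw [h.coe_conj ⟨k, by omega⟩, h.coe_conj ⟨k + 1, hk⟩]
    exact h.braid _ _ (Or.inl rfl)
  · intro k l hkl hl
    refine ext ?_
    simp only [ConjAct.ofConjAct_mul, Units.val_mul]
    rw [h.coe_conj ⟨k, by omega⟩, h.coe_conj ⟨l, hl⟩]
    exact h.gg_far _ _ (Or.inl hkl)
  · intro k hk
    simp only [dif_pos hk]
    exact (h.conj_smul_eq_iff ⟨k, hk⟩ _ _).2 (h.ge_same _)
  · intro k l hkl hl
    simp only [dif_pos hl]
    exact (h.conj_smul_eq_iff ⟨k, by omega⟩ _ _).2 (h.ge_far _ _ (Or.inl hkl))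
  · intro k l hkl hl
    simp only [dif_pos (show k < n - 1 by omega)]
    exact (h.conj_smul_eq_iff ⟨l, hl⟩ _ _).2 (h.ge_far _ _ (Or.inr hkl))
  · intro k hk
    simp only [dif_pos hk, dif_pos (show k < n - 1 by omega)]
    exact near ⟨k, by omega⟩ ⟨k + 1, hk⟩ (Or.inl rfl)
  · intro k hk
    simp only [dif_pos hk]
    exact sq ⟨k, by omega⟩ ⟨k + 1, hk⟩ (Or.inl rfl)
  · intro k hk
    simp only [dif_pos (show k < n - 1 by omega)]
    exact sq ⟨k + 1, hk⟩ ⟨k, by omega⟩ (Or.inr rfl)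

/-- The tie between two arbitrary letters: `e_i` for neighbouring letters `i`, `i + 1`, and a
conjugate of it under a product of the `g_k` for distinct letters in general, and `1` for equal
letters. -/
def tie (a b : Fin n) : A :=
  if a = b then 1
  else tieBetween h.conj (fun k => if hk : k < n - 1 then e ⟨k, hk⟩ else 0) a b

theorem tie_self (a : Fin n) : h.tie a a = 1 := if_pos rfl

theorem tie_symm (a b : Fin n) : h.tie a b = h.tie b a := by
  by_cases hab : a = b
  · rw [hab]
  · rw [tie, tie, if_neg hab, if_neg (Ne.symm hab),
      tieBetween_comm _ _ fun hv => hab (Fin.ext hv)]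

theorem tie_lo_hi (i : Fin (n - 1)) : h.tie (lo i) (hi i) = e i := by
  rw [tie, if_neg (lo_ne_hi i), tieBetween_eq (a := (lo i).val) (b := (hi i).val) _ _ 0 rfl]
  exact dif_pos i.2

theorem conj_smul_tie (i : Fin (n - 1)) (a b : Fin n) :
    h.conj i • h.tie a b = h.tie (simple i a) (simple i b) := by
  have ha := a.2
  have hb := b.2
  by_cases hab : a = b
  · rw [hab, tie_self, tie_self, smul_one]
  · rw [tie, tie, if_neg hab, if_neg fun hs => hab ((simple i).injective hs),
      h.isBraidAction.smul_tieBetween i.2 (by omega) (by omega) fun hv => hab (Fin.ext hv),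
      simple_val, simple_val]
    rfl

theorem exists_conj_smul_tie (σ : Equiv.Perm (Fin n)) :
    ∃ u : ConjAct Aˣ, ∀ a b, u • h.tie a b = h.tie (σ a) (σ b) := by
  induction σ using perm_induction_simple with
  | h1 => exact ⟨1, fun a b => one_smul _ _⟩
  | hs i => exact ⟨h.conj i, h.conj_smul_tie i⟩
  | hm σ τ hσ hτ =>
    obtain ⟨u, hu⟩ := hσ
    obtain ⟨v, hv⟩ := hτ
    exact ⟨u * v, fun a b => by
      rw [mul_smul, hv, hu, Equiv.Perm.mul_apply, Equiv.Perm.mul_apply]⟩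

/-- Letters in any position can be moved to the first positions by an inner automorphism. -/
theorem exists_conj_smul_tie_castLE {m : ℕ} {v : Fin m → Fin n} (hv : Function.Injective v)
    (hm : m ≤ n) : ∃ u : ConjAct Aˣ, ∀ k l,
      u • h.tie (v k) (v l) = h.tie (Fin.castLE hm k) (Fin.castLE hm l) := by
  obtain ⟨σ, hσ⟩ := Equiv.Perm.exists_extending_pair v (Fin.castLE hm) hv
    (Fin.castLE_injective hm)
  obtain ⟨u, hu⟩ := h.exists_conj_smul_tie σ
  exact ⟨u, fun k l => by rw [hu, hσ, hσ]⟩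

theorem tie_idem (a b : Fin n) : h.tie a b * h.tie a b = h.tie a b := by
  by_cases hab : a = b
  · rw [hab, tie_self, one_mul]
  have hv : Function.Injective ![a, b] := by
    intro k l hkl
    fin_cases k <;> fin_cases l <;> simp_all [eq_comm]
  have hm : 2 ≤ n := by simpa using Fintype.card_le_of_injective _ hv
  obtain ⟨u, hu⟩ := h.exists_conj_smul_tie_castLE hv hm
  have h1 := hu 0 1
  simp only [Matrix.cons_val] at h1
  apply smul_left_cancel u
  rw [smul_mul', h1, ← pow_two]
  have h2 := h.tie_lo_hi ⟨0, by omega⟩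
  have h3 := h.e_sq ⟨0, by omega⟩
  rwa [← h2] at h3

/-- The relations between two ties sharing one letter, deduced from those between `e_1` and
`e_2`. -/
theorem tie_comm_and_trans {a b d : Fin n} (hab : a ≠ b) (hbd : b ≠ d) (had : a ≠ d) :
    h.tie a b * h.tie b d = h.tie b d * h.tie a b ∧
      h.tie a b * h.tie b d = h.tie a b * h.tie a d := by
  have hv : Function.Injective ![a, b, d] := by
    intro k l hkl
    fin_cases k <;> fin_cases l <;> simp_all [eq_comm]
  have hm : 3 ≤ n := by simpa using Fintype.card_le_of_injective _ hv
  obtain ⟨u, hu⟩ := h.exists_conj_smul_tie_castLE hv hm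
  have h01 := hu 0 1
  have h12 := hu 1 2
  have h02 := hu 0 2
  simp only [Matrix.cons_val] at h01 h12 h02
  have e0 : h.tie (Fin.castLE hm 0) (Fin.castLE hm 1) = e ⟨0, by omega⟩ :=
    h.tie_lo_hi ⟨0, by omega⟩
  have e1 : h.tie (Fin.castLE hm 1) (Fin.castLE hm 2) = e ⟨1, by omega⟩ :=
    h.tie_lo_hi ⟨1, by omega⟩
  have e2 : h.tie (Fin.castLE hm 0) (Fin.castLE hm 2) * g ⟨1, by omega⟩ =
      g ⟨1, by omega⟩ * e ⟨0, by omega⟩ := by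
    have h3 := h.conj_smul_tie ⟨1, by omega⟩ (Fin.castLE hm 0) (Fin.castLE hm 1)
    rw [e0, h.conj_smul_eq_iff] at h3
    rw [h3]
    congr 2
  constructor
  · apply smul_left_cancel u
    rw [smul_mul', smul_mul', h01, h12, e0, e1, h.ee_comm]
  · apply smul_left_cancel u
    rw [smul_mul', smul_mul', h01, h12, h02, e0, e1]
    have h4 := h.eeg_left ⟨0, by omega⟩ ⟨1, by omega⟩ (Or.inl rfl)
    rw [mul_assoc (e _) (g _), ← e2, ← mul_assoc] at h4
    have h5 := congrArg (· * (g ⟨1, by omega⟩ - ((q : K) - (q⁻¹ : Kˣ)) • e ⟨1, by omega⟩)) h4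
    simpa only [mul_assoc, h.g_mul_self_sub, mul_one] using h5

theorem tie_comm (a b c d : Fin n) : h.tie a b * h.tie c d = h.tie c d * h.tie a b := by
  by_cases hab : a = b
  · rw [hab, tie_self, one_mul, mul_one]
  by_cases hcd : c = d
  · rw [hcd, tie_self, one_mul, mul_one]
  by_cases hac : a = c
  · by_cases hbd : b = d
    · rw [hac, hbd]
    · subst hac
      rw [h.tie_symm a b]
      exact (h.tie_comm_and_trans (Ne.symm hab) hcd hbd).1
  by_cases had : a = d
  · by_cases hbc : b = c
    · rw [had, hbc, h.tie_symm]
    · subst had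
      rw [h.tie_symm a b, h.tie_symm c a]
      exact (h.tie_comm_and_trans (Ne.symm hab) hac hbc).1
  by_cases hbc : b = c
  · subst hbc
    exact (h.tie_comm_and_trans hab hcd had).1
  by_cases hbd : b = d
  · subst hbd
    rw [h.tie_symm c b]
    exact (h.tie_comm_and_trans hab hbc hac).1
  have hv : Function.Injective ![a, b, c, d] := by
    intro k l hkl
    fin_cases k <;> fin_cases l <;> simp_all [eq_comm]
  have hm : 4 ≤ n := by simpa using Fintype.card_le_of_injective _ hv
  obtain ⟨u, hu⟩ := h.exists_conj_smul_tie_castLE hv hm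
  have h01 := hu 0 1
  have h23 := hu 2 3
  simp only [Matrix.cons_val] at h01 h23
  have e0 : h.tie (Fin.castLE hm 0) (Fin.castLE hm 1) = e ⟨0, by omega⟩ :=
    h.tie_lo_hi ⟨0, by omega⟩
  have e2 : h.tie (Fin.castLE hm 2) (Fin.castLE hm 3) = e ⟨2, by omega⟩ :=
    h.tie_lo_hi ⟨2, by omega⟩
  apply smul_left_cancel u
  rw [smul_mul', smul_mul', h01, h23, e0, e2, h.ee_comm]

theorem isTieSystem : IsTieSystem q g h.tie where
  g_far := h.gg_far
  g_braid i j hij := h.braid i j (Or.inl hij)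
  g_quad i := by rw [h.tie_lo_hi, h.g_quad]
  g_e i a b := (h.conj_smul_eq_iff i _ _).1 (h.conj_smul_tie i a b)
  e_self := h.tie_self
  e_symm := h.tie_symm
  e_comm := h.tie_comm
  e_idem := h.tie_idem
  e_trans a b d := by
    by_cases hab : a = b
    · rw [hab, tie_self]
    by_cases hbd : b = d
    · rw [← hbd, tie_self, h.tie_idem, mul_one]
    by_cases had : a = d
    · rw [← had, h.tie_symm b a, tie_self, h.tie_idem, mul_one]
    exact (h.tie_comm_and_trans hab hbd had).2

end IsBraidTie

end TiesOfBraidTie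

/-! ### Normal forms -/

section NormalForms

/-- The descending product `γ_{k + d - 1} ⋯ γ_{k + 1} γ_k`. -/
def desc {M : Type*} [Monoid M] (γ : ℕ → M) (k : ℕ) : ℕ → M
  | 0 => 1
  | d + 1 => γ (k + d) * desc γ k d

/-- The products `D_1 ⋯ D_m` in which each `D_j` is `γ_{j - 1} γ_{j - 2} ⋯ γ_k` for some
`k ≤ j`. -/
def normalForms {M : Type*} [Monoid M] (γ : ℕ → M) : ℕ → Set M
  | 0 => {1}
  | m + 1 => {y | ∃ x ∈ normalForms γ m, ∃ k d, k + d = m + 1 ∧ y = x * desc γ k d}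

section Monoid

variable {M : Type*} [Monoid M]

theorem desc_succ (γ : ℕ → M) (k d : ℕ) : desc γ k (d + 1) = desc γ (k + 1) d * γ k := by
  induction d with
  | zero => simp [desc]
  | succ d ih =>
    rw [desc, ih, desc, mul_assoc, show k + 1 + d = k + (d + 1) by omega]

theorem map_desc {M' : Type*} [Monoid M'] (φ : M →* M') (γ : ℕ → M) (k d : ℕ) :
    φ (desc γ k d) = desc (φ ∘ γ) k d := by
  induction d with
  | zero => exact map_one φ
  | succ d ih => rw [desc, desc, map_mul, ih, Function.comp_apply]

variable {γ : ℕ → M} {N : ℕ} (comm : ∀ k l, k + 1 < l → l < N → γ k * γ l = γ l * γ k)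
include comm

theorem desc_mul_of_lt {j k d : ℕ} (hj : j + 1 < k) (hN : k + d ≤ N) :
    desc γ k d * γ j = γ j * desc γ k d := by
  induction d with
  | zero => simp [desc]
  | succ d ih =>
    rw [desc, mul_assoc, ih (by omega), ← mul_assoc, ← comm j (k + d) (by omega) (by omega),
      mul_assoc]

theorem desc_mul_of_gt {l k d : ℕ} (hl : k + d < l) (hN : l < N) :
    desc γ k d * γ l = γ l * desc γ k d := by
  induction d with
  | zero => simp [desc]
  | succ d ih =>
    rw [desc, mul_assoc, ih (by omega), ← mul_assoc, comm (k + d) l (by omega) (by omega),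
      mul_assoc]

theorem desc_mul_of_mem
    (braid : ∀ k, k + 1 < N → γ k * γ (k + 1) * γ k = γ (k + 1) * γ k * γ (k + 1))
    {j k d : ℕ} (hk : k ≤ j) (hj : j + 1 < k + d) (hN : k + d ≤ N) :
    desc γ k d * γ (j + 1) = γ j * desc γ k d := by
  induction d with
  | zero => omega
  | succ d ih =>
    rcases Nat.lt_or_ge (j + 1) (k + d) with h | h
    · rw [desc, mul_assoc, ih h (by omega), ← mul_assoc, ← comm j (k + d) h (by omega), mul_assoc]
    · obtain ⟨d, rfl⟩ : ∃ c, d = c + 1 := ⟨d - 1, by omega⟩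
      obtain rfl : j = k + d := by omega
      rw [desc, desc, mul_assoc, mul_assoc, desc_mul_of_gt comm (by omega) (by omega),
        ← add_assoc, ← mul_assoc, ← mul_assoc, ← braid _ (by omega), mul_assoc, mul_assoc]

end Monoid

variable {K : Type*} [CommRing K] {n : ℕ} {A : Type*} [Ring A] [Algebra K A]

/-- The pairs `(g_k, s_k)`; indices out of range give the identity. -/
def genPair (g : Fin (n - 1) → A) (k : ℕ) : A × Equiv.Perm (Fin n) :=
  if hk : k < n - 1 then (g ⟨k, hk⟩, simple ⟨k, hk⟩) else 1

theorem genPair_of_lt (g : Fin (n - 1) → A) {k : ℕ} (hk : k < n - 1) :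
    genPair g k = (g ⟨k, hk⟩, simple ⟨k, hk⟩) :=
  dif_pos hk

/-- The monoid of all products of ties. -/
def tieMonoid (e : Fin n → Fin n → A) : Submonoid A :=
  Submonoid.closure (Set.range fun s : Fin n × Fin n => e s.1 s.2)

theorem tie_mem_tieMonoid (e : Fin n → Fin n → A) (a b : Fin n) : e a b ∈ tieMonoid e :=
  Submonoid.subset_closure ⟨(a, b), rfl⟩

/-- The span of the products of a product of ties with a normal form of level `m`. -/
def normalSpan (K : Type*) [CommRing K] [Algebra K A] (g : Fin (n - 1) → A)
    (e : Fin n → Fin n → A) (m : ℕ) : Submodule K A :=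
  Submodule.span K {z | ∃ p ∈ tieMonoid e, ∃ y ∈ normalForms (genPair g) m, z = p * y.1}

namespace IsTieSystem

variable {q : Kˣ} {g : Fin (n - 1) → A} {e : Fin n → Fin n → A} (h : IsTieSystem q g e)
include h

theorem g_mul_mem (i : Fin (n - 1)) {p : A} (hp : p ∈ tieMonoid e) :
    ∃ p' ∈ tieMonoid e, g i * p = p' * g i := by
  induction hp using Submonoid.closure_induction with
  | mem x hx =>
    obtain ⟨s, rfl⟩ := hx
    exact ⟨_, tie_mem_tieMonoid e _ _, h.g_e i s.1 s.2⟩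
  | one => exact ⟨1, one_mem _, by simp⟩
  | mul x y _ _ hx hy =>
    obtain ⟨x', hx', hxe⟩ := hx
    obtain ⟨y', hy', hye⟩ := hy
    exact ⟨x' * y', mul_mem hx' hy', by rw [← mul_assoc, hxe, mul_assoc, hye, mul_assoc]⟩

theorem genPair_mul_mem (k : ℕ) {p : A} (hp : p ∈ tieMonoid e) :
    ∃ p' ∈ tieMonoid e, (genPair g k).1 * p = p' * (genPair g k).1 := by
  by_cases hk : k < n - 1
  · rw [genPair_of_lt g hk]
    exact h.g_mul_mem _ hp
  · rw [genPair, dif_neg hk]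
    exact ⟨p, hp, by simp⟩

theorem desc_mul_mem (k d : ℕ) {p : A} (hp : p ∈ tieMonoid e) :
    ∃ p' ∈ tieMonoid e, (desc (genPair g) k d).1 * p = p' * (desc (genPair g) k d).1 := by
  induction d generalizing p with
  | zero => exact ⟨p, hp, by simp [desc]⟩
  | succ d ih =>
    obtain ⟨p₁, hp₁, h₁⟩ := ih hp
    obtain ⟨p₂, hp₂, h₂⟩ := h.genPair_mul_mem (k + d) hp₁
    exact ⟨p₂, hp₂, by rw [desc, Prod.fst_mul, mul_assoc, h₁, ← mul_assoc, h₂, mul_assoc]⟩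

theorem normalForm_mul_mem {m : ℕ} {y : A × Equiv.Perm (Fin n)}
    (hy : y ∈ normalForms (genPair g) m) {p : A} (hp : p ∈ tieMonoid e) :
    ∃ p' ∈ tieMonoid e, y.1 * p = p' * y.1 := by
  induction m generalizing y p with
  | zero =>
    obtain rfl : y = 1 := hy
    exact ⟨p, hp, by simp⟩
  | succ m ih =>
    obtain ⟨x, hx, k, d, -, rfl⟩ := hy
    obtain ⟨p₁, hp₁, h₁⟩ := h.desc_mul_mem k d hp
    obtain ⟨p₂, hp₂, h₂⟩ := ih hx hp₁
    exact ⟨p₂, hp₂, by rw [Prod.fst_mul, mul_assoc, h₁, ← mul_assoc, h₂, mul_assoc]⟩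

theorem mul_tie_mem_normalSpan {m : ℕ} {z : A} (hz : z ∈ normalSpan K g e m) (a b : Fin n) :
    z * e a b ∈ normalSpan K g e m := by
  induction hz using Submodule.span_induction with
  | mem z hz =>
    obtain ⟨p, hp, y, hy, rfl⟩ := hz
    obtain ⟨p', hp', hpe⟩ := h.normalForm_mul_mem hy (tie_mem_tieMonoid e a b)
    exact Submodule.subset_span ⟨p * p', mul_mem hp hp', y, hy, by
      rw [mul_assoc, hpe, mul_assoc]⟩
  | zero => rw [zero_mul]; exact zero_mem _
  | add x y _ _ hx hy => rw [add_mul]; exact add_mem hx hy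
  | smul c x _ hx => rw [smul_mul_assoc]; exact Submodule.smul_mem _ c hx

omit h in
theorem mul_desc_mem_normalSpan {m k d : ℕ} {z : A} (hz : z ∈ normalSpan K g e m)
    (hkd : k + d = m + 1) :
    z * (desc (genPair g) k d).1 ∈ normalSpan K g e (m + 1) := by
  induction hz using Submodule.span_induction with
  | mem z hz =>
    obtain ⟨p, hp, y, hy, rfl⟩ := hz
    exact Submodule.subset_span ⟨p, hp, _, ⟨y, hy, k, d, hkd, rfl⟩, by
      rw [Prod.fst_mul, mul_assoc]⟩
  | zero => rw [zero_mul]; exact zero_mem _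
  | add x y _ _ hx hy => rw [add_mul]; exact add_mem hx hy
  | smul c x _ hx => rw [smul_mul_assoc]; exact Submodule.smul_mem _ c hx

theorem genPair_comm (k l : ℕ) (hkl : k + 1 < l) (hl : l < n - 1) :
    (genPair g k).1 * (genPair g l).1 = (genPair g l).1 * (genPair g k).1 := by
  rw [genPair_of_lt g (show k < n - 1 by omega), genPair_of_lt g hl]
  exact h.g_far _ _ (Or.inl hkl)

theorem genPair_braid (k : ℕ) (hk : k + 1 < n - 1) :
    (genPair g k).1 * (genPair g (k + 1)).1 * (genPair g k).1 =
      (genPair g (k + 1)).1 * (genPair g k).1 * (genPair g (k + 1)).1 := by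
  rw [genPair_of_lt g (show k < n - 1 by omega), genPair_of_lt g hk]
  exact h.g_braid _ _ rfl

/-- The spans of normal forms are stable under right multiplication by the generators: a generator
`g_j` passes through `g_m ⋯ g_k` as `g_j` or `g_{j - 1}` or changes its length, and in the last
case the quadratic relation produces a tie that can be moved to the left. -/
theorem mul_genPair_mem_normalSpan {m j : ℕ} (hj : j < m) (hm : m ≤ n - 1) {z : A}
    (hz : z ∈ normalSpan K g e m) : z * (genPair g j).1 ∈ normalSpan K g e m := by
  induction m generalizing j z with
  | zero => omega
  | succ m ih =>
    induction hz using Submodule.span_induction with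
    | zero => rw [zero_mul]; exact zero_mem _
    | add x y _ _ hx hy => rw [add_mul]; exact add_mem hx hy
    | smul c x _ hx => rw [smul_mul_assoc]; exact Submodule.smul_mem _ c hx
    | mem z hz =>
      obtain ⟨p, hp, _, ⟨x, hx, k, d, hkd, rfl⟩, rfl⟩ := hz
      have hD : ∀ k d, (desc (genPair g) k d).1 = desc (fun k => (genPair g k).1) k d :=
        map_desc (MonoidHom.fst A (Equiv.Perm (Fin n))) (genPair g)
      have hpx : p * x.1 ∈ normalSpan K g e m := Submodule.subset_span ⟨p, hp, x, hx, rfl⟩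
      rw [Prod.fst_mul, ← mul_assoc, mul_assoc]
      rcases Nat.lt_or_ge (j + 1) k with h1 | h1
      · rw [hD, desc_mul_of_lt h.genPair_comm h1 (by omega), ← hD, ← mul_assoc]
        exact mul_desc_mem_normalSpan (ih (by omega) (by omega) hpx) hkd
      rcases Nat.eq_or_lt_of_le h1 with rfl | h1
      · rw [hD, ← desc_succ, ← hD]
        exact mul_desc_mem_normalSpan hpx (by omega)
      rcases Nat.eq_or_lt_of_le (Nat.le_of_lt_succ h1) with rfl | h1
      · obtain ⟨d, rfl⟩ : ∃ c, d = c + 1 := ⟨d - 1, by omega⟩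
        have hk : k < n - 1 := by omega
        have key : (desc (genPair g) k (d + 1)).1 * (genPair g k).1 =
            (desc (genPair g) (k + 1) d).1 + ((q : K) - (q⁻¹ : Kˣ)) •
              ((desc (genPair g) k (d + 1)).1 * e (lo ⟨k, hk⟩) (hi ⟨k, hk⟩)) := by
          rw [desc_succ, Prod.fst_mul, mul_assoc, mul_assoc, genPair_of_lt g hk]
          dsimp only
          rw [← pow_two, h.g_quad, h.g_e, simple_lo, simple_hi, h.e_symm (hi _), mul_add, mul_one,
            mul_smul_comm]
        rw [key, mul_add, mul_smul_comm, ← mul_assoc]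
        exact add_mem (mul_desc_mem_normalSpan hpx (by omega)) (Submodule.smul_mem _ _
          (h.mul_tie_mem_normalSpan (mul_desc_mem_normalSpan hpx hkd) _ _))
      · obtain ⟨j, rfl⟩ : ∃ c, j = c + 1 := ⟨j - 1, by omega⟩
        rw [hD, desc_mul_of_mem h.genPair_comm h.genPair_braid (by omega) (by omega) (by omega),
          ← hD, ← mul_assoc]
        exact mul_desc_mem_normalSpan (ih (by omega) (by omega) hpx) hkd

omit h in
theorem one_mem_normalForms {M : Type*} [Monoid M] (γ : ℕ → M) (m : ℕ) :
    1 ∈ normalForms γ m := by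
  induction m with
  | zero => rfl
  | succ m ih => exact ⟨1, ih, m + 1, 0, rfl, by simp [desc]⟩

omit h in
theorem one_mem_normalSpan (m : ℕ) : (1 : A) ∈ normalSpan K g e m :=
  Submodule.subset_span ⟨1, one_mem _, 1, one_mem_normalForms _ _, by simp⟩

end IsTieSystem

/-- The products of ties and normal forms span `E_n^K(q)`. -/
theorem BraidTieK.mem_normalSpan {q : Kˣ} {e : Fin n → Fin n → BraidTieK n q}
    (h : IsTieSystem q (BraidTieK.g q) e) (he : ∀ i, e (lo i) (hi i) = BraidTieK.e q i)
    (x : BraidTieK n q) : x ∈ normalSpan K (BraidTieK.g q) e (n - 1) := by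
  let S : Subalgebra K (BraidTieK n q) :=
    { carrier := {y | ∀ z ∈ normalSpan K (BraidTieK.g q) e (n - 1),
        z * y ∈ normalSpan K (BraidTieK.g q) e (n - 1)}
      mul_mem' := fun {y y'} hy hy' z hz => by
        rw [← mul_assoc]
        exact hy' _ (hy z hz)
      add_mem' := fun {y y'} hy hy' z hz => by
        rw [mul_add]
        exact add_mem (hy z hz) (hy' z hz)
      algebraMap_mem' := fun c z hz => by
        rw [← Algebra.commutes, ← Algebra.smul_def]
        exact Submodule.smul_mem _ c hz }
  have hx : x ∈ S := BraidTieK.mem_of_forall_mem S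
    (fun i z hz => by
      have := h.mul_genPair_mem_normalSpan i.2 le_rfl hz
      rwa [genPair_of_lt _ i.2] at this)
    (fun i z hz => by
      rw [← he]
      exact h.mul_tie_mem_normalSpan hz _ _) x
  have := hx 1 (IsTieSystem.one_mem_normalSpan _)
  rwa [one_mul] at this

/-! ### Normal forms and permutations -/

theorem desc_genPair_apply (g : Fin (n - 1) → A) {k d : ℕ} (hkd : k + d < n) :
    (desc (genPair g) k d).2 ⟨k, by omega⟩ = ⟨k + d, hkd⟩ := by
  induction d with
  | zero => rfl
  | succ d ih =>
    rw [desc, Prod.snd_mul, Equiv.Perm.mul_apply, ih (by omega), genPair_of_lt g (by omega)]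
    exact simple_lo ⟨k + d, by omega⟩

theorem desc_genPair_apply_of_gt (g : Fin (n - 1) → A) {k d : ℕ} {a : Fin n}
    (ha : k + d < a) : (desc (genPair g) k d).2 a = a := by
  induction d with
  | zero => rfl
  | succ d ih =>
    rw [desc, Prod.snd_mul, Equiv.Perm.mul_apply, ih (by omega), genPair_of_lt g (by omega)]
    exact simple_of_ne (by simp; omega) (by simp; omega)

theorem normalForms_apply_of_gt (g : Fin (n - 1) → A) {m : ℕ} {y : A × Equiv.Perm (Fin n)}
    (hy : y ∈ normalForms (genPair g) m) {a : Fin n} (ha : m < a) : y.2 a = a := by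
  induction m generalizing y with
  | zero =>
    obtain rfl : y = 1 := hy
    rfl
  | succ m ih =>
    obtain ⟨x, hx, k, d, hkd, rfl⟩ := hy
    rw [Prod.snd_mul, Equiv.Perm.mul_apply, desc_genPair_apply_of_gt g (by omega),
      ih hx (by omega)]

/-- A normal form is determined by its permutation. -/
theorem normalForms_snd_injOn (g : Fin (n - 1) → A) {m : ℕ} (hm : m ≤ n - 1) :
    Set.InjOn Prod.snd (normalForms (genPair g) m) := by
  induction m with
  | zero =>
    intro y hy y' hy' _
    exact (show y = 1 from hy).trans (show y' = 1 from hy').symm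
  | succ m ih =>
    rintro _ ⟨x, hx, k, d, hkd, rfl⟩ _ ⟨x', hx', k', d', hkd', rfl⟩ heq
    have hlast : ∀ {x : A × Equiv.Perm (Fin n)} {k d : ℕ}, x ∈ normalForms (genPair g) m →
        (hkd : k + d = m + 1) →
        (x * desc (genPair g) k d).2 ⟨k, by omega⟩ = ⟨m + 1, by omega⟩ := by
      intro x k d hx hkd
      rw [Prod.snd_mul, Equiv.Perm.mul_apply, desc_genPair_apply g (by omega)]
      simp only [hkd]
      exact normalForms_apply_of_gt g hx (Nat.lt_succ_self m)
    have h1 := hlast hx hkd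
    rw [show (x * desc (genPair g) k d).2 = (x' * desc (genPair g) k' d').2 from heq,
      ← hlast hx' hkd'] at h1
    obtain rfl : k = k' := congrArg Fin.val (Equiv.injective _ h1)
    obtain rfl : d = d' := by omega
    rw [ih (by omega) hx hx' (mul_right_cancel (heq : x.2 * _ = x'.2 * _))]

end NormalForms

/-! ### Products of ties -/

section TieMonoid

variable {K : Type*} [CommRing K] {n : ℕ} {A : Type*} [Ring A] [Algebra K A]

namespace IsTieSystem

variable {q : Kˣ} {g : Fin (n - 1) → A} {e : Fin n → Fin n → A} (h : IsTieSystem q g e)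
include h

theorem tie_mul_comm (a b : Fin n) {p : A} (hp : p ∈ tieMonoid e) :
    e a b * p = p * e a b := by
  induction hp using Submonoid.closure_induction with
  | mem x hx =>
    obtain ⟨s, rfl⟩ := hx
    exact h.e_comm _ _ _ _
  | one => simp
  | mul x y _ _ hx hy => rw [← mul_assoc, hx, mul_assoc, hy, mul_assoc]

theorem tieMonoid_mul_comm {p p' : A} (hp : p ∈ tieMonoid e) (hp' : p' ∈ tieMonoid e) :
    p * p' = p' * p := by
  induction hp using Submonoid.closure_induction with
  | mem x hx =>
    obtain ⟨s, rfl⟩ := hx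
    exact h.tie_mul_comm _ _ hp'
  | one => simp
  | mul x y _ _ hx hy => rw [mul_assoc, hy, ← mul_assoc, hx, mul_assoc]

/-- For a product of ties `p`, the pairs of letters `a`, `b` such that `e_{ab} p = p`. -/
def absorbed (e : Fin n → Fin n → A) (p : A) : Set (Fin n × Fin n) :=
  {s | e s.1 s.2 * p = p}

/-- An element is fixed by `p` as soon as it is fixed by all the ties that fix `p`. -/
theorem mul_eq_of_absorbed_subset {p x : A} (hp : p ∈ tieMonoid e)
    (hx : absorbed e p ⊆ absorbed e x) : p * x = x := by
  induction hp using Submonoid.closure_induction with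
  | mem y hy =>
    obtain ⟨s, rfl⟩ := hy
    exact hx (h.e_idem _ _ : s ∈ absorbed e (e s.1 s.2))
  | one => exact one_mul x
  | mul y z hy hz ihy ihz =>
    rw [mul_assoc, ihz fun s (hs : _ = _) => hx (show e s.1 s.2 * (y * z) = y * z by
        rw [← mul_assoc, h.tie_mul_comm _ _ hy, mul_assoc, hs]),
      ihy fun s (hs : _ = _) => hx (show e s.1 s.2 * (y * z) = y * z by rw [← mul_assoc, hs])]

omit h in
theorem absorbed_subset_of_mul_eq {p x : A} (hpx : p * x = x) :
    absorbed e p ⊆ absorbed e x := fun s (hs : _ = _) => by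
  rw [absorbed, Set.mem_ofPred_eq, ← hpx, ← mul_assoc, hs]

theorem eq_of_absorbed_eq {p x : A} (hp : p ∈ tieMonoid e) (hx : x ∈ tieMonoid e)
    (hpx : absorbed e p = absorbed e x) : p = x := by
  rw [← h.mul_eq_of_absorbed_subset hx hpx.ge, h.tieMonoid_mul_comm hx hp,
    h.mul_eq_of_absorbed_subset hp hpx.le]

/-- The partition of the letters attached to a product of ties. -/
def setoid (x : A) : Setoid (Fin n) where
  r a b := e a b * x = x
  iseqv :=
    { refl := fun a => by rw [h.e_self, one_mul]
      symm := fun {a b} hab => by rwa [h.e_symm]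
      trans := fun {a b d} hab hbd => by
        have h1 : e a b * e b d * x = x := by rw [mul_assoc, hbd, hab]
        rw [h.e_trans, h.e_comm, mul_assoc, hab] at h1
        exact h1 }

/-- If `r ≥ n`, the partition attached to a product of ties is given by an `r`-colouring. -/
theorem exists_colouring {r : ℕ} (hr : n ≤ r) (x : A) :
    ∃ t : Fin n → Fin r, ∀ a b, t a = t b ↔ e a b * x = x := by
  refine ⟨fun a => Fin.castLE hr (Quotient.out (Quotient.mk (h.setoid x) a)), fun a b => ?_⟩
  rw [(Fin.castLE_injective hr).eq_iff, Quotient.out_inj]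
  exact Quotient.eq (r := h.setoid x)

end IsTieSystem

end TieMonoid

/-! ### Faithfulness of the tensor space -/

section Faithful

open MulOpposite

variable {K : Type*} [CommRing K] {r n : ℕ} {A : Type*} [Ring A] [Algebra K A]

theorem opG_apply_of_gt (q : Kˣ) {i : Fin (n - 1)} {f : Fin n → Fin n × Fin r}
    (h : (f (hi i)).1 < (f (lo i)).1) :
    opG r q i (tensorBasis K r n f) = tensorBasis K r n (f ∘ simple i) := by
  rw [opG_apply, if_neg h.ne', if_pos h, ite_self]

/-- Moving a factor to the left past factors with larger lower indices only permutes the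
factors. -/
theorem desc_genPair_tensorBasis {q : Kˣ} {g : Fin (n - 1) → A}
    (ρ : A →ₐ[K] (Module.End K (TensorSpace K r n))ᵐᵒᵖ) (hρ : ∀ i, ρ (g i) = op (opG r q i))
    {k d : ℕ} (hkd : k + d < n) {f : Fin n → Fin n × Fin r}
    (hf : ∀ a : Fin n, a < k + d → (f ⟨k + d, hkd⟩).1 < (f a).1) :
    unop (ρ (desc (genPair g) k d).1) (tensorBasis K r n f) =
      tensorBasis K r n (f ∘ (desc (genPair g) k d).2) := by
  induction d generalizing f with
  | zero =>
    have h1 : ρ (desc (genPair g) k 0).1 = 1 := map_one ρ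
    rw [h1]
    rfl
  | succ d ih =>
    have hk : k + d < n - 1 := by omega
    rw [desc, genPair_of_lt g hk, Prod.fst_mul, map_mul, unop_mul, Module.End.mul_apply]
    dsimp only
    rw [hρ, unop_op, opG_apply_of_gt q (hf (lo ⟨k + d, hk⟩) (Nat.lt_succ_self _)),
      ih (by omega) fun a ha => ?_]
    · rfl
    · rw [Function.comp_apply, Function.comp_apply,
        simple_of_ne (a := a) (by simp; omega) (by simp; omega),
        show (⟨k + d, by omega⟩ : Fin n) = lo ⟨k + d, hk⟩ from rfl, simple_lo]
      exact hf a (by omega)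

/-- On a basis vector with decreasing lower indices a normal form acts by permuting the factors. -/
theorem normalForm_tensorBasis {q : Kˣ} {g : Fin (n - 1) → A}
    (ρ : A →ₐ[K] (Module.End K (TensorSpace K r n))ᵐᵒᵖ) (hρ : ∀ i, ρ (g i) = op (opG r q i))
    {m : ℕ} (hm : m ≤ n - 1) {y : A × Equiv.Perm (Fin n)} (hy : y ∈ normalForms (genPair g) m)
    {f : Fin n → Fin n × Fin r} (hf : ∀ a b, a < b → (f b).1 < (f a).1) :
    unop (ρ y.1) (tensorBasis K r n f) = tensorBasis K r n (f ∘ y.2) := by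
  induction m generalizing y with
  | zero =>
    obtain rfl : y = 1 := hy
    rw [Prod.fst_one, map_one]
    rfl
  | succ m ih =>
    obtain ⟨x, hx, k, d, hkd, rfl⟩ := hy
    rw [Prod.fst_mul, map_mul, unop_mul, Module.End.mul_apply, ih (by omega) hx,
      desc_genPair_tensorBasis ρ hρ (by omega) fun a ha => ?_]
    · rfl
    · refine hf _ _ ?_
      rw [normalForms_apply_of_gt g hx (a := ⟨k + d, by omega⟩) (by simp; omega), Fin.lt_def]
      -- The permutation fixes all positions beyond `m`, hence preserves those up to `m`.
      by_contra hlt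
      have h1 := normalForms_apply_of_gt g hx (a := x.2 a) (by simp at hlt; omega)
      rw [x.2.injective h1] at hlt
      exact hlt ha

/-- If the upper indices of a basis vector induce the partition attached to `x`, then a product of
ties `p` fixes the vector if `p x = x` and kills it otherwise. -/
theorem tieMonoid_tensorBasis {e : Fin n → Fin n → A} {q : Kˣ} {g : Fin (n - 1) → A}
    (h : IsTieSystem q g e) (ρ : A →ₐ[K] (Module.End K (TensorSpace K r n))ᵐᵒᵖ)
    (hρ : ∀ a b, ρ (e a b) = op (opTie K r a b)) {x : A} {f : Fin n → Fin n × Fin r}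
    (hf : ∀ a b, (f a).2 = (f b).2 ↔ e a b * x = x) {p : A} (hp : p ∈ tieMonoid e) :
    (p * x = x ∧ unop (ρ p) (tensorBasis K r n f) = tensorBasis K r n f) ∨
      (p * x ≠ x ∧ unop (ρ p) (tensorBasis K r n f) = 0) := by
  induction hp using Submonoid.closure_induction with
  | mem y hy =>
    obtain ⟨s, rfl⟩ := hy
    dsimp only
    rw [hρ, unop_op, opTie_apply]
    split_ifs with hs
    · exact Or.inl ⟨(hf _ _).1 hs, rfl⟩
    · exact Or.inr ⟨fun hx => hs ((hf _ _).2 hx), rfl⟩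
  | one => exact Or.inl ⟨one_mul x, by rw [map_one]; rfl⟩
  | mul y z hy hz ihy ihz =>
    rw [map_mul, unop_mul, Module.End.mul_apply]
    have h1 : y * z * x = x → y * x = x ∧ z * x = x := fun hyz => by
      have hsub := IsTieSystem.absorbed_subset_of_mul_eq (e := e) hyz
      constructor
      · exact h.mul_eq_of_absorbed_subset hy fun s (hs : _ = _) =>
          hsub (show e s.1 s.2 * (y * z) = y * z by rw [← mul_assoc, hs])
      · exact h.mul_eq_of_absorbed_subset hz fun s (hs : _ = _) =>
          hsub (show e s.1 s.2 * (y * z) = y * z by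
            rw [h.tieMonoid_mul_comm hy hz, ← mul_assoc, hs])
    rcases ihy with ⟨hy1, hy2⟩ | ⟨hy1, hy2⟩
    · rw [hy2]
      rcases ihz with ⟨hz1, hz2⟩ | ⟨hz1, hz2⟩
      · exact Or.inl ⟨by rw [mul_assoc, hz1, hy1], hz2⟩
      · exact Or.inr ⟨fun hyz => hz1 (h1 hyz).2, hz2⟩
    · exact Or.inr ⟨fun hyz => hy1 (h1 hyz).1, by rw [hy2, map_zero]⟩

/-- The operators given by the products of a product of ties with a normal form are linearly
independent. -/
theorem linearIndependent_of_isTieSystem {e : Fin n → Fin n → A} {q : Kˣ} {g : Fin (n - 1) → A}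
    (hr : n ≤ r) (h : IsTieSystem q g e) (ρ : A →ₐ[K] (Module.End K (TensorSpace K r n))ᵐᵒᵖ)
    (hg : ∀ i, ρ (g i) = op (opG r q i)) (he : ∀ a b, ρ (e a b) = op (opTie K r a b))
    (c : tieMonoid e × normalForms (genPair g) (n - 1) →₀ K)
    (hc : ρ (Finsupp.linearCombination K
      (fun z : tieMonoid e × normalForms (genPair g) (n - 1) => (z.1 : A) * z.2.1.1) c) = 0) :
    c = 0 := by
  classical
  -- Evaluation at a basis vector coloured by the partition attached to `x`.
  have key : ∀ (x : tieMonoid e) (y : normalForms (genPair g) (n - 1)),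
      ∑ z ∈ c.support, (if (z.1 : A) * x = x ∧ z.2 = y then c z else 0) = 0 := by
    intro x y
    obtain ⟨t, ht⟩ := h.exists_colouring hr (x : A)
    let f : Fin n → Fin n × Fin r := fun a => (Fin.rev a, t a)
    have hf : ∀ a b, a < b → (f b).1 < (f a).1 := fun a b hab => Fin.rev_lt_rev.2 hab
    have h1 : ∀ z : tieMonoid e × normalForms (genPair g) (n - 1),
        (tensorBasis K r n).repr (unop (ρ ((z.1 : A) * z.2.1.1)) (tensorBasis K r n f))
          (f ∘ y.1.2) = if (z.1 : A) * x = x ∧ z.2 = y then 1 else 0 := by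
      intro z
      rw [map_mul, unop_mul, Module.End.mul_apply]
      rcases tieMonoid_tensorBasis h ρ he (f := f) ht z.1.2 with ⟨hz, hz'⟩ | ⟨hz, hz'⟩
      · rw [hz', normalForm_tensorBasis ρ hg le_rfl z.2.2 hf, Module.Basis.repr_self,
          Finsupp.single_apply]
        refine if_congr ⟨fun hfz => ⟨hz, Subtype.ext ?_⟩, fun hzy => by rw [hzy.2]⟩ rfl rfl
        refine normalForms_snd_injOn g le_rfl z.2.2 y.2 (Equiv.ext fun a => ?_)
        exact Fin.rev_injective (congrArg Prod.fst (congrFun hfz a))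
      · rw [hz', map_zero, map_zero, if_neg fun hzy => hz hzy.1]
        rfl
    have h2 := congrArg (fun F : (Module.End K (TensorSpace K r n))ᵐᵒᵖ =>
      (tensorBasis K r n).repr (unop F (tensorBasis K r n f))
      (f ∘ y.1.2)) hc
    simp only [Finsupp.linearCombination_apply, Finsupp.sum, map_sum, map_smul, Finset.unop_sum,
      unop_smul, LinearMap.sum_apply, LinearMap.smul_apply, Finsupp.finsetSum_apply,
      Finsupp.smul_apply, h1, unop_zero, LinearMap.zero_apply, map_zero, Finsupp.zero_apply,
      smul_eq_mul, mul_ite, mul_one, mul_zero] at h2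
    exact h2
  -- The system is triangular with respect to refinement of partitions.
  have main : ∀ (k : ℕ) (x : tieMonoid e) (y : normalForms (genPair g) (n - 1)),
      (IsTieSystem.absorbed e (x : A)).ncard = k → c (x, y) = 0 := by
    intro k
    induction k using Nat.strong_induction_on with
    | _ k ih =>
      intro x y hk
      have h1 := key x y
      rw [Finset.sum_eq_single (x, y)] at h1
      · rwa [if_pos ⟨h.mul_eq_of_absorbed_subset x.2 subset_rfl, rfl⟩] at h1
      · rintro ⟨p, y'⟩ - hne
        refine ite_eq_right_iff.2 ?_
        rintro ⟨hpx, rfl⟩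
        have hsub := IsTieSystem.absorbed_subset_of_mul_eq (e := e) hpx
        refine ih _ ?_ p y' rfl
        rw [← hk]
        refine Set.ncard_lt_ncard (hsub.ssubset_of_ne fun heq => hne ?_) (Set.toFinite _)
        rw [Subtype.ext (h.eq_of_absorbed_eq p.2 x.2 heq)]
      · intro hx
        rw [Finsupp.notMem_support_iff.1 hx, ite_self]
  ext ⟨x, y⟩
  exact main _ x y rfl

/-- A representation is determined on all ties by its values on the generators, as the ties are
conjugate. -/
theorem IsBraidTie.map_tie {q : Kˣ} {g e : Fin (n - 1) → A} (h : IsBraidTie q g e)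
    (ρ : A →ₐ[K] (Module.End K (TensorSpace K r n))ᵐᵒᵖ)
    (hg : ∀ i, ρ (g i) = op (opG r q i)) (he : ∀ i, ρ (e i) = op (opE K r i)) (a b : Fin n) :
    ρ (h.tie a b) = op (opTie K r a b) := by
  have hT := isTieSystem_op (K := K) (r := r) (n := n) q
  by_cases hab : a = b
  · rw [hab, h.tie_self, map_one]
    exact (hT.e_self b).symm
  have hσ : ∀ (σ : Equiv.Perm (Fin n)) (a b : Fin n), ρ (h.tie a b) = op (opTie K r a b) →
      ρ (h.tie (σ a) (σ b)) = op (opTie K r (σ a) (σ b)) := by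
    intro σ
    induction σ using perm_induction_simple with
    | h1 => exact fun a b => id
    | hs i =>
      intro a b hab
      have hu : IsUnit (ρ (g i)) :=
        IsUnit.map ρ ⟨⟨g i, _, h.g_mul_self_sub i, h.self_sub_mul_g i⟩, rfl⟩
      refine hu.mul_right_cancel ?_
      rw [← map_mul, ← h.isTieSystem.g_e, map_mul, hab, hg]
      exact hT.g_e i a b
    | hm σ τ hσ hτ => exact fun a b hab => hσ _ _ (hτ _ _ hab)
  have h2 : 2 ≤ n := by
    have h1 : a.val ≠ b.val := fun hv => hab (Fin.ext hv)
    omega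
  have h0 : 0 < n - 1 := by omega
  obtain ⟨σ, hσab⟩ := Equiv.Perm.exists_extending_pair
    ![lo (⟨0, h0⟩ : Fin (n - 1)), hi (⟨0, h0⟩ : Fin (n - 1))] ![a, b]
    (by
      have := lo_ne_hi (⟨0, h0⟩ : Fin (n - 1))
      intro k l hkl
      fin_cases k <;> fin_cases l <;> simp_all [eq_comm])
    (by
      intro k l hkl
      fin_cases k <;> fin_cases l <;> simp_all [eq_comm])
  have ha := hσab 0
  have hb := hσab 1
  simp only [Matrix.cons_val] at ha hb
  rw [← ha, ← hb]
  refine hσ σ _ _ ?_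
  rw [h.tie_lo_hi, he, opTie_lo_hi]

theorem BraidTieK.injective_of_apply {q : Kˣ} (hr : n ≤ r)
    (ρ : BraidTieK n q →ₐ[K] (Module.End K (TensorSpace K r n))ᵐᵒᵖ)
    (hg : ∀ i, ρ (BraidTieK.g q i) = op (opG r q i))
    (he : ∀ i, ρ (BraidTieK.e q i) = op (opE K r i)) : Function.Injective ρ := by
  have hB := BraidTieK.isBraidTie (n := n) q
  have h := hB.isTieSystem
  have hρ : ∀ a b, ρ (hB.tie a b) = op (opTie K r a b) :=
    hB.map_tie ρ hg he
  rw [injective_iff_map_eq_zero]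
  intro x hx
  have hspan := BraidTieK.mem_normalSpan h hB.tie_lo_hi x
  have hset : {z | ∃ p ∈ tieMonoid hB.tie, ∃ y ∈ normalForms (genPair (BraidTieK.g q)) (n - 1),
      z = p * y.1} = Set.range (fun z : tieMonoid hB.tie ×
        normalForms (genPair (BraidTieK.g q)) (n - 1) => (z.1 : BraidTieK n q) * z.2.1.1) := by
    ext z
    constructor
    · rintro ⟨p, hp, y, hy, rfl⟩
      exact ⟨(⟨p, hp⟩, ⟨y, hy⟩), rfl⟩
    · rintro ⟨⟨p, y⟩, rfl⟩
      exact ⟨p, p.2, y, y.2, rfl⟩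
  rw [normalSpan, hset, Finsupp.mem_span_range_iff_exists_finsupp] at hspan
  obtain ⟨c, rfl⟩ := hspan
  rw [linearIndependent_of_isTieSystem hr h ρ hg hρ c hx]
  exact Finsupp.sum_zero_index

end Faithful

end BraidsTies

end

theorem mainTheorem6 {K : Type*} [CommRing K] (q : Kˣ) (n r : ℕ) (hn : 0 < n) (hr : n ≤ r) :
    (∀ (ξ : Kˣ) (h : BraidsTies.IsAdmissible r ξ),
      ∃ φ : BraidsTies.BraidTieK n q →ₐ[K] BraidsTies.YokonumaHeckeK n h q,
        (∀ i : Fin (n - 1),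
          φ (BraidsTies.BraidTieK.g q i) = BraidsTies.YokonumaHeckeK.g h q i ∧
          φ (BraidsTies.BraidTieK.e q i) = BraidsTies.YokonumaHeckeK.e h q i) ∧
        (∀ ψ : BraidsTies.BraidTieK n q →ₐ[K] BraidsTies.YokonumaHeckeK n h q,
          (∀ i : Fin (n - 1),
            ψ (BraidsTies.BraidTieK.g q i) = BraidsTies.YokonumaHeckeK.g h q i ∧
            ψ (BraidsTies.BraidTieK.e q i) = BraidsTies.YokonumaHeckeK.e h q i) → ψ = φ) ∧
        Function.Injective φ) ∧
    (∃ ρ : BraidsTies.BraidTieK n q →ₐ[K] (Module.End K (BraidsTies.TensorSpace K r n))ᵐᵒᵖ,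
        (∀ i : Fin (n - 1),
          ρ (BraidsTies.BraidTieK.g q i) = MulOpposite.op (BraidsTies.opG r q i) ∧
          ρ (BraidsTies.BraidTieK.e q i) = MulOpposite.op (BraidsTies.opE K r i)) ∧
        Function.Injective ρ) := by
  refine ⟨fun ξ h => ?_, ?_⟩
  · have hY := BraidsTies.YokonumaHeckeK.isYokonuma (n := n) h q
    obtain ⟨φ, hφ⟩ := (hY.isTieSystem
      (BraidsTies.YokonumaHeckeK.natCast_mul_scalarHom h)).isBraidTie.exists_algHom
    simp only [← BraidsTies.YokonumaHeckeK.e_eq] at hφ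
    refine ⟨φ, hφ, fun ψ hψ => BraidsTies.BraidTieK.algHom_ext
      (fun i => (hψ i).1.trans (hφ i).1.symm) (fun i => (hψ i).2.trans (hφ i).2.symm), ?_⟩
    -- The action on the tensor space factors through `φ`.
    obtain ⟨ρ, hρg, hρt⟩ := BraidsTies.YokonumaHeckeK.exists_algHom
      (BraidsTies.isYokonuma_op (n := n) h q)
    have hρe : ∀ i, ρ (BraidsTies.YokonumaHeckeK.e h q i) =
        MulOpposite.op (BraidsTies.opE K r i) := fun i => by
      rw [BraidsTies.YokonumaHeckeK.e_eq, ← BraidsTies.opTie_lo_hi, ← BraidsTies.yTie_op_opT h]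
      simp only [BraidsTies.yTie, map_smul, map_sum, map_mul, map_pow, hρt]
    refine Function.Injective.of_comp (f := ρ) ?_
    rw [← AlgHom.coe_comp]
    exact BraidsTies.BraidTieK.injective_of_apply hr (ρ.comp φ)
      (fun i => (congrArg ρ (hφ i).1).trans (hρg i)) fun i => (congrArg ρ (hφ i).2).trans (hρe i)
  · have hT := BraidsTies.isTieSystem_op (K := K) (r := r) (n := n) q
    obtain ⟨ρ, hρ⟩ := hT.isBraidTie.exists_algHom
    simp only [BraidsTies.opTie_lo_hi] at hρ
    exact ⟨ρ, hρ, BraidsTies.BraidTieK.injective_of_apply hr ρ (fun i => (hρ i).1)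
      fun i => (hρ i).2⟩
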